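/- Let $\Xi$ be a complete separable metric space. All compact metric spaces below are nonempty, and products carry the max metric. Let $\mathcal T$ be the set of equivalence classes of pairs $(X,\varphi)$ of a compact metric space $X$ and a continuous function $\varphi:X\to\Xi$, where $(X,\varphi)$ and $(Y,\psi)$ are equivalent if $\psi\circ e=\varphi$ for some isometry $e$ of $X$ onto $Y$, with the distance $$d\big((X,\varphi),(Y,\psi)\big)=\inf_R\Big\{\tfrac12\,\mathrm{dis}(R)\ \vee\sup_{(x,y)\in R} d(\varphi(x),\psi(y))\Big\}.$$ Here $R$ runs over all correspondences of $X$ and $Y$, that is, all $R\subseteq X\times Y$ which project onto $X$ and onto $Y$, and $\mathrm{dis}(R)=\sup\{|d(x,x')-d(y,y')| : (x,y),(x',y')\in R\}$. Let $\mathcal T_*$ be the set of equivalence classes of triples $(X,o,\varphi)$ with in addition a root $o\in X$ (the isometries preserve roots), with the same formula for the distance, where only those $R$ are allowed that contain the pair of the two roots. For a compact metric space $X$, let $\tau(X)$ be the set of nonempty compact subsets of $X\times\Xi$ (1-marked compact subsets of $X$) with the Hausdorff metric, and let $\tau_*(X)=X\times\tau(X)$. For an isometric embedding $f:X\to Z$,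 let $\tau_f(K)=\{(f(x),\xi):(x,\xi)\in K\}$ and $(\tau_*)_f(o,K)=(f(o),\tau_f(K))$. For $\sigma\in\{\tau,\tau_*\}$, let $\mathcal C_\sigma$ be the set of pairs $(X,a)$ of a compact metric space $X$ and $a\in\sigma(X)$, where $(X,a)$ and $(X',a')$ are identified if $\sigma_e(a)=a'$ for some isometry $e$ of $X$ onto $X'$, with the distance $$d\big((X,a),(Y,b)\big)=\inf_{Z,f,g}\big\{d_H(f(X),g(Y))\vee d(\sigma_f(a),\sigma_g(b))\big\},$$ where $d_H$ is the Hausdorff distance and the infimum is over all compact metric spaces $Z$ and all isometric embeddings $f:X\to Z$ and $g:Y\to Z$. **Proposition.** The distances above are metrics on $\mathcal T$, $\mathcal T_*$, $\mathcal C_\tau$ and $\mathcal C_{\tau_*}$, and $\mathcal C_\tau$ and $\mathcal C_{\tau_*}$ are complete and separable. The map $(X,\varphi)\mapsto(X,\mathrm{gr}_\varphi)$, where $\mathrm{gr}_\varphi=\{(x,\varphi(x)):x\in X\}$, is an isometric embedding of $\mathcal T$ into $\mathcal C_\tau$, and its image is an $F_{\sigma\delta}$ subset, hence a Borel subset, of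 $\mathcal C_\tau$. The map $(X,o,\varphi)\mapsto(X,(o,\mathrm{gr}_\varphi))$ is a homeomorphism of $\mathcal T_*$ onto its image in $\mathcal C_{\tau_*}$, which is an $F_{\sigma\delta}$ subset, hence a Borel subset, of $\mathcal C_{\tau_*}$. -/

import Mathlib

open Set TopologicalSpace

universe u v w

noncomputable section

namespace SpatialTrees

/-! ### Compact metric spaces and functors on them -/

/-- An object of the category of (nonempty) compact metric spaces. -/
structure CompObj : Type (u + 1) where
  carrier : Type u
  [metric : MetricSpace carrier]
  [compact : CompactSpace carrier]
  [nonempty : Nonempty carrier]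

instance : CoeSort CompObj.{u} (Type u) := ⟨CompObj.carrier⟩

attribute [instance] CompObj.metric CompObj.compact CompObj.nonempty

/-- A functor from compact metric spaces to metric spaces, where the morphisms on both sides are
the isometric embeddings. -/
structure CompFunctor : Type (max (u + 1) (w + 1)) where
  obj : CompObj.{u} → Type w
  [metric : ∀ X, MetricSpace (obj X)]
  map : ∀ {X Y : CompObj.{u}} (f : X → Y), Isometry f → obj X → obj Y
  isometry_map : ∀ {X Y : CompObj.{u}} (f : X → Y) (hf : Isometry f), Isometry (map f hf)
  map_id : ∀ (X : CompObj.{u}) (a : obj X), map (id : X → X) isometry_id a = a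
  map_comp : ∀ {X Y Z : CompObj.{u}} (f : X → Y) (g : Y → Z) (hf : Isometry f) (hg : Isometry g)
    (a : obj X), map (g ∘ f) (hg.comp hf) a = map g hg (map f hf a)

attribute [instance] CompFunctor.metric

/-- Pairs `(X, a)` of a compact metric space `X` and an additional structure `a ∈ τ(X)`. -/
structure Structured (τ : CompFunctor.{u, w}) : Type (max (u + 1) w) where
  space : CompObj.{u}
  str : τ.obj space

/-- `(X, a)` and `(Y, b)` are equivalent if some isometry of `X` onto `Y` maps `a` to `b`. -/
def Structured.Equivalent {τ : CompFunctor.{u, w}} (p q : Structured τ) : Prop :=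
  ∃ e : p.space ≃ᵢ q.space, τ.map e e.isometry p.str = q.str

theorem Structured.equivalence (τ : CompFunctor.{u, w}) :
    Equivalence (Structured.Equivalent (τ := τ)) where
  refl p := ⟨IsometryEquiv.refl _, τ.map_id _ _⟩
  symm := by
    rintro p q ⟨e, he⟩
    refine ⟨e.symm, ?_⟩
    rw [← he, ← τ.map_comp e e.symm e.isometry e.symm.isometry]
    have : (e.symm : q.space → p.space) ∘ e = id := by ext x; simp
    simp only [this]
    exact τ.map_id _ _
  trans := by
    rintro p q r ⟨e, he⟩ ⟨e', he'⟩
    refine ⟨e.trans e', ?_⟩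
    rw [← he', ← he, ← τ.map_comp e e' e.isometry e'.isometry]
    rfl

instance Structured.setoid (τ : CompFunctor.{u, w}) : Setoid (Structured τ) :=
  ⟨Structured.Equivalent, Structured.equivalence τ⟩

/-- The set `𝒞_τ` of equivalence classes of pairs `(X, a)`. -/
def CSpace (τ : CompFunctor.{u, w}) : Type (max (u + 1) w) :=
  Quotient (Structured.setoid τ)

/-- The Gromov–Hausdorff-functor distance on `𝒞_τ`: the infimum of
`d_H(f(X), g(Y)) ∨ d(τ_f(a), τ_g(b))` over all compact metric spaces `Z`, all isometric embeddings
`f : X → Z` and `g : Y → Z`, and all representatives `(X, a)`, `(Y, b)` of the two classes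
(the infimum over `Z, f, g` does not depend on the representatives). -/
def ghfDist (τ : CompFunctor.{u, w}) (p q : CSpace τ) : ℝ :=
  sInf {r : ℝ | ∃ P Q : Structured τ, (⟦P⟧ : CSpace τ) = p ∧ (⟦Q⟧ : CSpace τ) = q ∧
    ∃ (Z : CompObj.{u}) (f : P.space → Z) (g : Q.space → Z) (hf : Isometry f) (hg : Isometry g),
      r = max (Metric.hausdorffDist (range f) (range g))
        (dist (τ.map f hf P.str) (τ.map g hg Q.str))}

/-! ### Points, 1-marked compact subsets, and pairs of these -/

/-- The functor `τ(X) = X`. -/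
def pointFunctor : CompFunctor.{u, u} where
  obj X := X
  map f _ := f
  isometry_map _ hf := hf
  map_id _ _ := rfl
  map_comp _ _ _ _ _ := rfl

theorem isometry_nonemptyCompacts_map {α β : Type*} [MetricSpace α] [MetricSpace β] (f : α → β)
    (hf : Isometry f) : Isometry (NonemptyCompacts.map f hf.continuous) := by
  refine Isometry.of_dist_eq fun K L => ?_
  simp only [Metric.NonemptyCompacts.dist_eq, NonemptyCompacts.coe_map,
    Metric.hausdorffDist_image hf]

theorem isometry_markMap (Ξ : Type v) [MetricSpace Ξ] {X Y : CompObj.{u}} (f : X → Y)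
    (hf : Isometry f) : Isometry (Prod.map f id : X × Ξ → Y × Ξ) :=
  hf.prodMap isometry_id

/-- The functor of 1-marked compact subsets with mark space `Ξ`: `τ(X)` is the set of nonempty
compact subsets of `X × Ξ` (max product metric) with the Hausdorff metric, and `τ_f` is the image
under `(x, ξ) ↦ (f x, ξ)`. -/
def markedFunctor (Ξ : Type v) [MetricSpace Ξ] : CompFunctor.{u, max u v} where
  obj X := NonemptyCompacts (X × Ξ)
  map f hf := NonemptyCompacts.map (Prod.map f id) (isometry_markMap Ξ f hf).continuous
  isometry_map f hf := isometry_nonemptyCompacts_map _ (isometry_markMap Ξ f hf)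
  map_id X K := by
    ext z
    simp
  map_comp f g hf hg K := by
    refine NonemptyCompacts.ext ?_
    simp only [NonemptyCompacts.coe_map, ← image_comp]
    rfl

/-- The product of two functors, with the max product metric on `τ₁(X) × τ₂(X)`. -/
def prodFunctor (τ₁ : CompFunctor.{u, v}) (τ₂ : CompFunctor.{u, w}) :
    CompFunctor.{u, max v w} where
  obj X := τ₁.obj X × τ₂.obj X
  map f hf := Prod.map (τ₁.map f hf) (τ₂.map f hf)
  isometry_map f hf := (τ₁.isometry_map f hf).prodMap (τ₂.isometry_map f hf)
  map_id X a := Prod.ext (τ₁.map_id X a.1) (τ₂.map_id X a.2)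
  map_comp f g hf hg a := Prod.ext (τ₁.map_comp f g hf hg a.1) (τ₂.map_comp f g hf hg a.2)

/-- The functor whose structures are pairs of a point and a 1-marked compact subset. -/
def pointedMarkedFunctor (Ξ : Type v) [MetricSpace Ξ] : CompFunctor.{u, max u v} :=
  prodFunctor pointFunctor.{u} (markedFunctor.{u, v} Ξ)

/-! ### Correspondences -/

/-- `R` is a correspondence between `X` and `Y`: both projections of `R` are onto. -/
def IsCorrespondence {X Y : Type*} (R : Set (X × Y)) : Prop :=
  Prod.fst '' R = univ ∧ Prod.snd '' R = univ

/-- The distortion of a relation. -/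
def distortion {X Y : Type*} [MetricSpace X] [MetricSpace Y] (R : Set (X × Y)) : ℝ :=
  sSup {r : ℝ | ∃ p ∈ R, ∃ q ∈ R, r = |dist p.1 q.1 - dist p.2 q.2|}

/-- The quantity `½ dis(R) ∨ sup_{(x, y) ∈ R} d(φ(x), ψ(y))`. -/
def correspondenceCost {X Y Ξ : Type*} [MetricSpace X] [MetricSpace Y] [MetricSpace Ξ]
    (φ : X → Ξ) (ψ : Y → Ξ) (R : Set (X × Y)) : ℝ :=
  max (1 / 2 * distortion R) (sSup {r : ℝ | ∃ p ∈ R, r = dist (φ p.1) (ψ p.2)})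

/-! ### Compact metric spaces with a continuous function to `Ξ` -/

/-- Pairs `(X, φ)` of a compact metric space `X` and a continuous function `φ : X → Ξ`. -/
structure FunctionSpace (Ξ : Type v) [MetricSpace Ξ] : Type (max (u + 1) v) where
  space : CompObj.{u}
  func : C(space, Ξ)

/-- `(X, φ)` and `(Y, ψ)` are equivalent if `ψ ∘ e = φ` for some isometry `e` of `X` onto `Y`. -/
def FunctionSpace.Equivalent {Ξ : Type v} [MetricSpace Ξ] (p q : FunctionSpace.{u, v} Ξ) : Prop :=
  ∃ e : p.space ≃ᵢ q.space, ∀ x, q.func (e x) = p.func x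

instance FunctionSpace.setoid (Ξ : Type v) [MetricSpace Ξ] : Setoid (FunctionSpace.{u, v} Ξ) where
  r := FunctionSpace.Equivalent
  iseqv :=
    { refl := fun p => ⟨IsometryEquiv.refl _, fun _ => rfl⟩
      symm := by
        rintro p q ⟨e, he⟩
        exact ⟨e.symm, fun y => by rw [← he, e.apply_symm_apply]⟩
      trans := by
        rintro p q r ⟨e, he⟩ ⟨e', he'⟩
        exact ⟨e.trans e', fun x => (he' (e x)).trans (he x)⟩ }

/-- The set `𝒯` of equivalence classes of pairs `(X, φ)`. -/
def TSpace (Ξ : Type v) [MetricSpace Ξ] : Type (max (u + 1) v) :=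
  Quotient (FunctionSpace.setoid.{u, v} Ξ)

/-- The distance on `𝒯`: the infimum of `½ dis(R) ∨ sup_{(x, y) ∈ R} d(φ(x), ψ(y))` over all
correspondences `R` (and all representatives of the two classes, on which it does not depend). -/
def tDist {Ξ : Type v} [MetricSpace Ξ] (p q : TSpace.{u, v} Ξ) : ℝ :=
  sInf {r : ℝ | ∃ P Q : FunctionSpace.{u, v} Ξ,
    (⟦P⟧ : TSpace Ξ) = p ∧ (⟦Q⟧ : TSpace Ξ) = q ∧
      ∃ R : Set (P.space × Q.space), IsCorrespondence R ∧
        r = correspondenceCost P.func Q.func R}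

/-- Triples `(X, o, φ)` of a compact metric space `X`, a root `o ∈ X` and a continuous function
`φ : X → Ξ`. -/
structure PointedFunctionSpace (Ξ : Type v) [MetricSpace Ξ] : Type (max (u + 1) v) where
  space : CompObj.{u}
  root : space
  func : C(space, Ξ)

/-- Equivalence of triples: by an isometry which preserves the roots and the functions. -/
def PointedFunctionSpace.Equivalent {Ξ : Type v} [MetricSpace Ξ]
    (p q : PointedFunctionSpace.{u, v} Ξ) : Prop :=
  ∃ e : p.space ≃ᵢ q.space, e p.root = q.root ∧ ∀ x, q.func (e x) = p.func x

instance PointedFunctionSpace.setoid (Ξ : Type v) [MetricSpace Ξ] :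
    Setoid (PointedFunctionSpace.{u, v} Ξ) where
  r := PointedFunctionSpace.Equivalent
  iseqv :=
    { refl := fun p => ⟨IsometryEquiv.refl _, rfl, fun _ => rfl⟩
      symm := by
        rintro p q ⟨e, ho, he⟩
        exact ⟨e.symm, by rw [← ho, e.symm_apply_apply],
          fun y => by rw [← he, e.apply_symm_apply]⟩
      trans := by
        rintro p q r ⟨e, ho, he⟩ ⟨e', ho', he'⟩
        exact ⟨e.trans e', (congrArg e' ho).trans ho', fun x => (he' (e x)).trans (he x)⟩ }

/-- The set `𝒯_*` of equivalence classes of triples `(X, o, φ)`. -/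
def PointedTSpace (Ξ : Type v) [MetricSpace Ξ] : Type (max (u + 1) v) :=
  Quotient (PointedFunctionSpace.setoid.{u, v} Ξ)

/-- The distance on `𝒯_*`: as on `𝒯`, but only with correspondences that contain the pair of the
two roots. -/
def pointedTDist {Ξ : Type v} [MetricSpace Ξ] (p q : PointedTSpace.{u, v} Ξ) : ℝ :=
  sInf {r : ℝ | ∃ P Q : PointedFunctionSpace.{u, v} Ξ,
    (⟦P⟧ : PointedTSpace Ξ) = p ∧ (⟦Q⟧ : PointedTSpace Ξ) = q ∧
      ∃ R : Set (P.space × Q.space), IsCorrespondence R ∧ (P.root, Q.root) ∈ R ∧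
        r = correspondenceCost P.func Q.func R}

/-! ### Identification of functions with their graphs -/

/-- The graph `{(x, φ(x)) : x ∈ X}` as a nonempty compact subset of `X × Ξ`. -/
def graphCompact {Ξ : Type v} [MetricSpace Ξ] (X : CompObj.{u}) (φ : C(X, Ξ)) :
    NonemptyCompacts (X × Ξ) where
  carrier := range fun x => (x, φ x)
  isCompact' := isCompact_range (by fun_prop)
  nonempty' := range_nonempty _

theorem map_graphCompact {Ξ : Type v} [MetricSpace Ξ] {X Y : CompObj.{u}} (φ : C(X, Ξ))
    (ψ : C(Y, Ξ)) (e : X ≃ᵢ Y) (he : ∀ x, ψ (e x) = φ x) :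
    (markedFunctor.{u, v} Ξ).map e e.isometry (graphCompact X φ) = graphCompact Y ψ := by
  refine NonemptyCompacts.ext ?_
  change Prod.map e id '' (range fun x => (x, φ x)) = range fun y => (y, ψ y)
  rw [← range_comp]
  refine Eq.trans ?_ (e.surjective.range_comp fun y => (y, ψ y))
  congr 1
  funext x
  simp [he]

/-- The map `𝒯 → 𝒞_τ`, `(X, φ) ↦ (X, graph of φ)`. -/
def graphMap (Ξ : Type v) [MetricSpace Ξ] : TSpace.{u, v} Ξ → CSpace (markedFunctor.{u, v} Ξ) :=
  Quotient.map (fun P => ⟨P.space, graphCompact P.space P.func⟩) (by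
    rintro P Q ⟨e, he⟩
    exact ⟨e, map_graphCompact P.func Q.func e he⟩)

/-- The map `𝒯_* → 𝒞_τ`, `(X, o, φ) ↦ (X, (o, graph of φ))`. -/
def pointedGraphMap (Ξ : Type v) [MetricSpace Ξ] :
    PointedTSpace.{u, v} Ξ → CSpace (pointedMarkedFunctor.{u, v} Ξ) :=
  Quotient.map (fun P => ⟨P.space, (P.root, graphCompact P.space P.func)⟩) (by
    rintro P Q ⟨e, ho, he⟩
    exact ⟨e, Prod.ext ho (map_graphCompact P.func Q.func e he)⟩)

/-- `F_{σδ}` sets: countable intersections of countable unions of closed sets. -/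
def IsFSigmaDelta {α : Type*} [TopologicalSpace α] (S : Set α) : Prop :=
  ∃ F : ℕ → ℕ → Set α, (∀ n m, IsClosed (F n m)) ∧ S = ⋂ n, ⋃ m, F n m

end SpatialTrees

end

/-!
A triple `(Z, f, g)` as in the distance on `𝒞_τ` is a coupling of `X` and `Y`. Gluing two couplings
along their common space gives the triangle inequality. If the distance of two classes vanishes,
then the couplings of `X` and `Y` with costs tending to `0` have, along an ultrafilter, a limit
isometry of `X` onto `Y`. Successive gluing places a rapidly Cauchy sequence into one compact metric
space, where it converges. Every class is approximated by a class over a finite metric space, which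
embeds into some cube `[0, M]^n` with the maximum metric.

A correspondence of cost less than `r` gives a coupling in which corresponding points are at
distance less than `r`, and conversely a coupling gives the correspondence of the pairs of close
points with close marks. Hence the graph map is isometric on `𝒯`. On `𝒯_*` a small distance of the
images makes the roots close but a priori not their marks, hence
`(X, o, φ) ↦ (X, (φ(o), (o, gr_φ)))` is isometric, while omitting `φ(o)` preserves the
topology only.

A compact subset of `X × Ξ` is the graph of a continuous function on `X` if and only if it projects
onto `X` and has for every `ε` some modulus of continuity `δ`. For fixed `δ` and `ε` this is a
closed condition.
-/

noncomputable section

namespace SpatialTrees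

open Filter Topology Metric

/-! ### Couplings -/

section Coupling

theorem dist_nonemptyCompacts_le_iff {α : Type*} [MetricSpace α] {K L : NonemptyCompacts α}
    {r : ℝ} :
    dist K L ≤ r ↔ (∀ x ∈ K, ∃ y ∈ L, dist x y ≤ r) ∧ ∀ y ∈ L, ∃ x ∈ K, dist x y ≤ r := by
  have exists_dist_le : ∀ K L : NonemptyCompacts α, ∀ x ∈ K, ∃ y ∈ L, dist x y ≤ dist K L := by
    intro K L x hx
    obtain ⟨y, hy, hxy⟩ := L.isCompact.exists_infDist_eq_dist L.nonempty x
    exact ⟨y, hy, hxy ▸ infDist_le_hausdorffDist_of_mem hx (edist_ne_top K L)⟩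
  refine ⟨fun h => ⟨fun x hx => ?_, fun y hy => ?_⟩, fun ⟨h, h'⟩ => ?_⟩
  · obtain ⟨y, hy, hxy⟩ := exists_dist_le K L x hx
    exact ⟨y, hy, hxy.trans h⟩
  · obtain ⟨x, hx, hyx⟩ := exists_dist_le L K y hy
    exact ⟨x, hx, by rw [dist_comm]; exact hyx.trans (dist_comm L K ▸ h)⟩
  · obtain ⟨x, hx⟩ := K.nonempty
    obtain ⟨y, -, hxy⟩ := h x hx
    rw [NonemptyCompacts.dist_eq]
    refine hausdorffDist_le_of_mem_dist (dist_nonneg.trans hxy) h fun y hy => ?_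
    simp only [dist_comm y]
    exact h' y hy

/-- The nonempty compact set `f(X)`. -/
def rangeCompacts {X α : Type*} [TopologicalSpace X] [CompactSpace X] [Nonempty X]
    [TopologicalSpace α] {f : X → α} (hf : Continuous f) : NonemptyCompacts α :=
  ⟨⟨range f, isCompact_range hf⟩, range_nonempty f⟩

theorem dist_rangeCompacts_le_iff {X Y α : Type*} [TopologicalSpace X] [CompactSpace X]
    [Nonempty X] [TopologicalSpace Y] [CompactSpace Y] [Nonempty Y] [MetricSpace α] {f : X → α}
    {g : Y → α} {hf : Continuous f} {hg : Continuous g} {r : ℝ} :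
    dist (rangeCompacts hf) (rangeCompacts hg) ≤ r ↔
      (∀ x, ∃ y, dist (f x) (g y) ≤ r) ∧ ∀ y, ∃ x, dist (f x) (g y) ≤ r :=
  dist_nonemptyCompacts_le_iff.trans <| and_congr
    (forall_mem_range.trans <| forall_congr' fun _ => exists_range_iff)
    (forall_mem_range.trans <| forall_congr' fun _ => exists_range_iff)

theorem compactSpace_of_range_union_range_eq_univ {X Y α : Type*} [TopologicalSpace X]
    [CompactSpace X] [TopologicalSpace Y] [CompactSpace Y] [TopologicalSpace α] {f : X → α}
    {g : Y → α} (hf : Continuous f) (hg : Continuous g) (h : range f ∪ range g = univ) :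
    CompactSpace α :=
  ⟨h ▸ (isCompact_range hf).union (isCompact_range hg)⟩

/-- A coupling of `X` and `Y` consists of isometric embeddings of `X` and `Y` into a common compact
metric space. These are the `(Z, f, g)` in the definition of the distance on `𝒞_τ`. -/
structure Coupling (X Y : CompObj.{u}) : Type (u + 1) where
  space : CompObj.{u}
  inl : X → space
  inr : Y → space
  isometry_inl : Isometry inl
  isometry_inr : Isometry inr

theorem exists_coupling_of_distortion_le {X Y : CompObj.{u}} {ι : Type*} [Nonempty ι] (s : ι → X)
    (t : ι → Y) {r : ℝ} (hr : 0 < r)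
    (h : ∀ i j, |dist (s i) (s j) - dist (t i) (t j)| ≤ 2 * r) :
    ∃ c : Coupling X Y, ∀ i, dist (c.inl (s i)) (c.inr (t i)) = r := by
  let _ : MetricSpace (X ⊕ Y) := glueMetricApprox s t r hr h
  have hl : Isometry (Sum.inl : X → X ⊕ Y) := Isometry.of_dist_eq fun _ _ => rfl
  have hr : Isometry (Sum.inr : Y → X ⊕ Y) := Isometry.of_dist_eq fun _ _ => rfl
  have := compactSpace_of_range_union_range_eq_univ hl.continuous hr.continuous
    range_inl_union_range_inr
  exact ⟨⟨⟨X ⊕ Y⟩, Sum.inl, Sum.inr, hl, hr⟩, fun i => glueDist_glued_points s t r i⟩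

instance (X Y : CompObj.{u}) : Nonempty (Coupling X Y) :=
  let ⟨c, _⟩ := exists_coupling_of_distortion_le (fun _ : Unit => Classical.arbitrary X)
    (fun _ => Classical.arbitrary Y) one_pos (by simp)
  ⟨c⟩

theorem range_toGlueL_union_range_toGlueR {X Y Z : Type*} [Nonempty Z] [MetricSpace X]
    [MetricSpace Y] [MetricSpace Z] {Φ : Z → X} {Ψ : Z → Y} (hΦ : Isometry Φ) (hΨ : Isometry Ψ) :
    range (toGlueL hΦ hΨ) ∪ range (toGlueR hΦ hΨ) = univ := by
  refine eq_univ_of_forall fun z => ?_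
  obtain ⟨x | y, rfl⟩ := Quotient.exists_rep z
  exacts [Or.inl ⟨x, rfl⟩, Or.inr ⟨y, rfl⟩]

theorem exists_coupling_comp_eq_comp {X Y A : CompObj.{u}} {f : A → X} {g : A → Y}
    (hf : Isometry f) (hg : Isometry g) : ∃ c : Coupling X Y, c.inl ∘ f = c.inr ∘ g := by
  have : CompactSpace (GlueSpace hf hg) := compactSpace_of_range_union_range_eq_univ
    (toGlueL_isometry hf hg).continuous (toGlueR_isometry hf hg).continuous
    (range_toGlueL_union_range_toGlueR hf hg)
  have : Nonempty (GlueSpace hf hg) := ⟨toGlueL hf hg (Classical.arbitrary X)⟩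
  exact ⟨⟨⟨GlueSpace hf hg⟩, toGlueL hf hg, toGlueR hf hg, toGlueL_isometry hf hg,
    toGlueR_isometry hf hg⟩, toGlue_commute hf hg⟩

end Coupling

/-! ### The Gromov–Hausdorff-functor distance -/

section GhfDist

variable {τ : CompFunctor.{u, w}}

/-- The image of a structured space `(X, a)` under an isometric embedding `f : X → Z`: the compact
set `f(X)` together with `τ_f(a)`. The distance on `𝒞_τ` minimizes the distance of such images. -/
def Structured.place (P : Structured τ) {Z : CompObj.{u}} {f : P.space → Z} (hf : Isometry f) :
    NonemptyCompacts Z × τ.obj Z :=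
  (rangeCompacts hf.continuous, τ.map f hf P.str)

theorem Structured.place_congr (P : Structured τ) {Z : CompObj.{u}} {f g : P.space → Z}
    (h : f = g) (hf : Isometry f) (hg : Isometry g) : P.place hf = P.place hg := by
  subst h
  rfl

theorem Structured.place_comp (P : Structured τ) {Z W : CompObj.{u}} {f : P.space → Z} {k : Z → W}
    (hf : Isometry f) (hk : Isometry k) :
    P.place (hk.comp hf) =
      Prod.map (NonemptyCompacts.map k hk.continuous) (τ.map k hk) (P.place hf) :=
  Prod.ext (NonemptyCompacts.ext (range_comp k f)) (τ.map_comp f k hf hk P.str)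

theorem Structured.dist_place_comp (P Q : Structured τ) {Z W : CompObj.{u}} {f : P.space → Z}
    {g : Q.space → Z} {k : Z → W} (hf : Isometry f) (hg : Isometry g) (hk : Isometry k) :
    dist (P.place (hk.comp hf)) (Q.place (hk.comp hg)) = dist (P.place hf) (Q.place hg) := by
  rw [P.place_comp, Q.place_comp]
  exact ((isometry_nonemptyCompacts_map k hk).prodMap (τ.isometry_map k hk)).dist_eq _ _

theorem Structured.place_comp_isometryEquiv {P Q : Structured τ} {e : P.space ≃ᵢ Q.space}
    (he : τ.map e e.isometry P.str = Q.str) {Z : CompObj.{u}} {f : Q.space → Z}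
    (hf : Isometry f) : P.place (hf.comp e.isometry) = Q.place hf :=
  Prod.ext (NonemptyCompacts.ext (e.surjective.range_comp f))
    ((τ.map_comp e f e.isometry hf P.str).trans (congrArg _ he))

/-- The quantity `d_H(f(X), g(Y)) ∨ d(τ_f(a), τ_g(b))`. -/
def Coupling.cost (P Q : Structured τ) (c : Coupling P.space Q.space) : ℝ :=
  dist (P.place c.isometry_inl) (Q.place c.isometry_inr)

theorem ghfDist_le_cost (P Q : Structured τ) (c : Coupling P.space Q.space) :
    ghfDist τ ⟦P⟧ ⟦Q⟧ ≤ c.cost P Q := by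
  refine csInf_le ⟨0, ?_⟩
    ⟨P, Q, rfl, rfl, c.space, c.inl, c.inr, c.isometry_inl, c.isometry_inr, rfl⟩
  rintro _ ⟨_, _, _, _, _, _, _, _, _, rfl⟩
  exact le_max_of_le_right dist_nonneg

theorem ghfDist_lt_iff (P Q : Structured τ) {r : ℝ} :
    ghfDist τ ⟦P⟧ ⟦Q⟧ < r ↔ ∃ c : Coupling P.space Q.space, c.cost P Q < r := by
  refine ⟨fun h => ?_, fun ⟨c, hc⟩ => (ghfDist_le_cost P Q c).trans_lt hc⟩
  obtain ⟨c⟩ := (inferInstance : Nonempty (Coupling P.space Q.space))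
  obtain ⟨_, ⟨P', Q', hP, hQ, Z, f, g, hf, hg, rfl⟩, hr⟩ := exists_lt_of_csInf_lt
    (by exact ⟨_, P, Q, rfl, rfl, c.space, c.inl, c.inr, c.isometry_inl, c.isometry_inr, rfl⟩) h
  obtain ⟨e, he⟩ : P.Equivalent P' := Quotient.exact hP.symm
  obtain ⟨e', he'⟩ : Q.Equivalent Q' := Quotient.exact hQ.symm
  refine ⟨⟨Z, f ∘ e, g ∘ e', hf.comp e.isometry, hg.comp e'.isometry⟩, ?_⟩
  rw [Coupling.cost, Structured.place_comp_isometryEquiv he,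
    Structured.place_comp_isometryEquiv he']
  exact hr

theorem ghfDist_lt_iff_exists_le (P Q : Structured τ) {r : ℝ} :
    ghfDist τ ⟦P⟧ ⟦Q⟧ < r ↔ ∃ c : Coupling P.space Q.space, ∃ s < r, c.cost P Q ≤ s :=
  (ghfDist_lt_iff P Q).trans <| exists_congr fun _ =>
    ⟨fun h => ⟨_, h, le_rfl⟩, fun ⟨_, hs, h⟩ => h.trans_lt hs⟩

theorem ghfDist_nonneg (p q : CSpace τ) : 0 ≤ ghfDist τ p q := by
  refine Real.sInf_nonneg ?_
  rintro _ ⟨_, _, _, _, _, _, _, _, _, rfl⟩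
  exact le_max_of_le_right dist_nonneg

theorem ghfDist_self (p : CSpace τ) : ghfDist τ p p = 0 := by
  obtain ⟨P, rfl⟩ := Quotient.exists_rep p
  refine le_antisymm ?_ (ghfDist_nonneg _ _)
  exact (ghfDist_le_cost P P ⟨P.space, id, id, isometry_id, isometry_id⟩).trans (dist_self _).le

theorem ghfDist_comm (p q : CSpace τ) : ghfDist τ p q = ghfDist τ q p := by
  suffices ∀ p q : CSpace τ, ghfDist τ p q ≤ ghfDist τ q p from le_antisymm (this p q) (this q p)
  intro p q
  obtain ⟨P, rfl⟩ := Quotient.exists_rep p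
  obtain ⟨Q, rfl⟩ := Quotient.exists_rep q
  refine le_of_forall_gt fun r hr => ?_
  obtain ⟨c, hc⟩ := (ghfDist_lt_iff Q P).1 hr
  exact (ghfDist_lt_iff P Q).2
    ⟨⟨c.space, c.inr, c.inl, c.isometry_inr, c.isometry_inl⟩, (dist_comm _ _).trans_lt hc⟩

theorem exists_cost_le_add (P Q R : Structured τ) (c : Coupling P.space Q.space)
    (c' : Coupling Q.space R.space) :
    ∃ d : Coupling P.space R.space, d.cost P R ≤ c.cost P Q + c'.cost Q R := by
  obtain ⟨d, hd⟩ := exists_coupling_comp_eq_comp c.isometry_inr c'.isometry_inl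
  refine ⟨⟨d.space, d.inl ∘ c.inl, d.inr ∘ c'.inr, d.isometry_inl.comp c.isometry_inl,
    d.isometry_inr.comp c'.isometry_inr⟩, ?_⟩
  rw [Coupling.cost, Coupling.cost, Coupling.cost,
    ← P.dist_place_comp Q c.isometry_inl c.isometry_inr d.isometry_inl,
    ← Q.dist_place_comp R c'.isometry_inl c'.isometry_inr d.isometry_inr,
    ← Q.place_congr hd]
  exact dist_triangle _ _ _

theorem ghfDist_triangle (p q r : CSpace τ) : ghfDist τ p r ≤ ghfDist τ p q + ghfDist τ q r := by
  obtain ⟨P, rfl⟩ := Quotient.exists_rep p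
  obtain ⟨Q, rfl⟩ := Quotient.exists_rep q
  obtain ⟨R, rfl⟩ := Quotient.exists_rep r
  refine le_of_forall_pos_lt_add fun ε hε => ?_
  obtain ⟨c, hc⟩ := (ghfDist_lt_iff P Q).1 (lt_add_of_pos_right _ (half_pos hε))
  obtain ⟨c', hc'⟩ := (ghfDist_lt_iff Q R).1 (lt_add_of_pos_right _ (half_pos hε))
  obtain ⟨d, hd⟩ := exists_cost_le_add P Q R c c'
  exact (ghfDist_lt_iff P R).2 ⟨d, by linarith⟩

end GhfDist

/-! ### The metric -/

section Ultralimit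

theorem tendsto_dist_of_tendsto_hausdorffDist {X Y ι : Type*} [MetricSpace X] [CompactSpace X]
    [Nonempty X] [MetricSpace Y] [CompactSpace Y] [Nonempty Y] (l : Ultrafilter ι)
    {Z : ι → Type*} [∀ i, MetricSpace (Z i)] {f : ∀ i, X → Z i} {g : ∀ i, Y → Z i}
    (hf : ∀ i, Isometry (f i)) (hg : ∀ i, Isometry (g i))
    (h : Tendsto (fun i => dist (rangeCompacts (hf i).continuous) (rangeCompacts (hg i).continuous))
      l (𝓝 0)) (x : X) :
    ∃ y, Tendsto (fun i => dist (f i x) (g i y)) l (𝓝 0) := by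
  choose y hy using fun i => (dist_rangeCompacts_le_iff (hf := (hf i).continuous)
    (hg := (hg i).continuous)).1 le_rfl |>.1 x
  have hlim : Tendsto y l (𝓝 (l.map y).lim) := (l.map y).le_nhds_lim
  refine ⟨(l.map y).lim, squeeze_zero (fun _ => dist_nonneg) (fun i => ?_)
    (by simpa using h.add (tendsto_iff_dist_tendsto_zero.1 hlim))⟩
  rw [← (hg i).dist_eq (y i)]
  exact (dist_triangle _ (g i (y i)) _).trans (add_le_add_left (hy i) _)

theorem eq_of_tendsto_dist {Y ι : Type*} [MetricSpace Y] {l : Filter ι} [l.NeBot] {Z : ι → Type*}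
    [∀ i, MetricSpace (Z i)] {z : ∀ i, Z i} {g : ∀ i, Y → Z i} (hg : ∀ i, Isometry (g i))
    {y y' : Y} (h : Tendsto (fun i => dist (z i) (g i y)) l (𝓝 0))
    (h' : Tendsto (fun i => dist (z i) (g i y')) l (𝓝 0)) : y = y' := by
  refine dist_le_zero.1 (ge_of_tendsto' (by simpa using h.add h') fun i => ?_)
  rw [← (hg i).dist_eq]
  exact dist_triangle_left _ _ _

section

variable {X Y ι : Type*} [MetricSpace X] [MetricSpace Y] {l : Filter ι} {Z : ι → Type*}
  [∀ i, MetricSpace (Z i)] {f : ∀ i, X → Z i} {g : ∀ i, Y → Z i}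

theorem isometry_of_tendsto_dist [l.NeBot] (hf : ∀ i, Isometry (f i)) (hg : ∀ i, Isometry (g i))
    {e : X → Y} (he : ∀ x, Tendsto (fun i => dist (f i x) (g i (e x))) l (𝓝 0)) :
    Isometry e := by
  refine Isometry.of_dist_eq fun x x' => dist_le_zero.1 ?_
  refine ge_of_tendsto' (by simpa using (he x).add (he x')) fun i => ?_
  rw [← (hf i).dist_eq, ← (hg i).dist_eq, dist_comm]
  exact dist_dist_dist_le _ _ _ _

theorem eventually_forall_dist_le [CompactSpace X] (hf : ∀ i, Isometry (f i))
    (hg : ∀ i, Isometry (g i)) {e : X → Y} (he_isom : Isometry e)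
    (he : ∀ x, Tendsto (fun i => dist (f i x) (g i (e x))) l (𝓝 0)) {ε : ℝ} (hε : 0 < ε) :
    ∀ᶠ i in l, ∀ x, dist (f i x) (g i (e x)) ≤ ε := by
  obtain ⟨t, -, ht, htX⟩ := finite_cover_balls_of_compact (isCompact_univ (X := X))
    (show 0 < ε / 3 by positivity)
  filter_upwards [(eventually_all_finite ht).2 fun x _ =>
    (he x).eventually_le_const (show 0 < ε / 3 by positivity)] with i hi x
  obtain ⟨y, hy, hxy⟩ := mem_iUnion₂.1 (htX (mem_univ x))
  have := dist_triangle4 (f i x) (f i y) (g i (e y)) (g i (e x))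
  rw [(hf i).dist_eq, (hg i).dist_eq, he_isom.dist_eq, dist_comm y] at this
  linarith [hi y hy, mem_ball.1 hxy]

end

theorem exists_isometryEquiv_of_tendsto_hausdorffDist {X Y ι : Type*} [MetricSpace X]
    [CompactSpace X] [Nonempty X] [MetricSpace Y] [CompactSpace Y] [Nonempty Y]
    (l : Ultrafilter ι) {Z : ι → Type*} [∀ i, MetricSpace (Z i)] {f : ∀ i, X → Z i}
    {g : ∀ i, Y → Z i} (hf : ∀ i, Isometry (f i)) (hg : ∀ i, Isometry (g i))
    (h : Tendsto (fun i => dist (rangeCompacts (hf i).continuous) (rangeCompacts (hg i).continuous))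
      l (𝓝 0)) :
    ∃ e : X ≃ᵢ Y, ∀ ε > 0, ∀ᶠ i in l, ∀ x, dist (f i x) (g i (e x)) ≤ ε := by
  choose e he using tendsto_dist_of_tendsto_hausdorffDist l hf hg h
  choose e' he' using tendsto_dist_of_tendsto_hausdorffDist l hg hf
    (by simpa only [dist_comm] using h)
  have he_isom : Isometry e := isometry_of_tendsto_dist hf hg he
  have he_inv : ∀ y, e (e' y) = y := fun y => eq_of_tendsto_dist hg (he (e' y))
    (by simpa only [dist_comm] using he' y)
  exact ⟨.mk' e e' he_inv he_isom, fun ε hε => eventually_forall_dist_le hf hg he_isom he hε⟩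

end Ultralimit

/-- `f ↦ τ_f(a)` is nonexpansive with respect to the supremum distance on isometric embeddings. -/
class CompFunctor.IsNonexpansive (τ : CompFunctor.{u, w}) : Prop where
  dist_map_le : ∀ {X Z : CompObj.{u}} {f g : X → Z} (hf : Isometry f) (hg : Isometry g)
    (a : τ.obj X) {r : ℝ}, (∀ x, dist (f x) (g x) ≤ r) → dist (τ.map f hf a) (τ.map g hg a) ≤ r

section Metric

variable {τ : CompFunctor.{u, w}} [τ.IsNonexpansive]

theorem dist_map_str_le (P Q : Structured τ) (c : Coupling P.space Q.space)
    (e : P.space ≃ᵢ Q.space) {r : ℝ} (h : ∀ x, dist (c.inl x) (c.inr (e x)) ≤ r) :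
    dist (τ.map e e.isometry P.str) Q.str ≤ r + c.cost P Q := by
  rw [← (τ.isometry_map _ c.isometry_inr).dist_eq, ← τ.map_comp e c.inr e.isometry c.isometry_inr]
  refine (dist_triangle_left _ _ (τ.map c.inl c.isometry_inl P.str)).trans (add_le_add ?_ ?_)
  · exact CompFunctor.IsNonexpansive.dist_map_le _ _ _ h
  · exact le_max_right _ _

theorem eq_of_ghfDist_eq_zero {p q : CSpace τ} (h : ghfDist τ p q = 0) : p = q := by
  obtain ⟨P, rfl⟩ := Quotient.exists_rep p
  obtain ⟨Q, rfl⟩ := Quotient.exists_rep q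
  choose c hc using fun n : ℕ => (ghfDist_lt_iff P Q (r := 1 / ((n : ℝ) + 1))).1
    (by rw [h]; positivity)
  have hcost : Tendsto (fun n => (c n).cost P Q) (hyperfilter ℕ) (𝓝 0) :=
    (squeeze_zero (fun _ => dist_nonneg) (fun n => (hc n).le)
      tendsto_one_div_add_atTop_nhds_zero_nat).mono_left Nat.hyperfilter_le_atTop
  obtain ⟨e, he⟩ := exists_isometryEquiv_of_tendsto_hausdorffDist (hyperfilter ℕ)
    (fun n => (c n).isometry_inl) (fun n => (c n).isometry_inr)
    (squeeze_zero (fun _ => dist_nonneg) (fun _ => le_max_left _ _) hcost)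
  refine Quotient.sound ⟨e, dist_le_zero.1 (le_of_forall_pos_le_add fun ε hε => ?_)⟩
  obtain ⟨n, hn, hn'⟩ := ((he _ (half_pos hε)).and
    (hcost.eventually_le_const (half_pos hε))).exists
  exact (dist_map_str_le P Q (c n) e hn).trans (by linarith)

instance : MetricSpace (CSpace τ) where
  dist := ghfDist τ
  dist_self := ghfDist_self
  dist_comm := ghfDist_comm
  dist_triangle := ghfDist_triangle
  eq_of_dist_eq_zero := eq_of_ghfDist_eq_zero

end Metric

/-- If `f(X)` lies in the closed `r`-neighborhood of `g(Y)`, then `τ_f(τ(X))` lies in the closed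
`r`-neighborhood of `τ_g(τ(Y))`. -/
class CompFunctor.IsHausdorffNonexpansive (τ : CompFunctor.{u, w}) : Prop where
  exists_dist_map_le : ∀ {X Y Z : CompObj.{u}} {f : X → Z} {g : Y → Z} (hf : Isometry f)
    (hg : Isometry g) {r : ℝ}, (∀ x, ∃ y, dist (f x) (g y) ≤ r) →
      ∀ a, ∃ b, dist (τ.map f hf a) (τ.map g hg b) ≤ r

/-! ### Completeness -/

section SuccessiveGluing

/-- A metric space together with an isometric embedding of `A`. -/
structure MetricExtension (A : Type u) [MetricSpace A] : Type (u + 1) where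
  carrier : Type u
  [metric : MetricSpace carrier]
  embed : A → carrier
  isometry_embed : Isometry embed

attribute [instance] MetricExtension.metric

variable {A Z : ℕ → Type u} [∀ n, MetricSpace (A n)] [∀ n, Nonempty (A n)]
  [∀ n, MetricSpace (Z n)] {f : ∀ n, A n → Z n} {g : ∀ n, A n → Z (n + 1)}

/-- The spaces `Z 0, …, Z n`, where `Z k` and `Z (k + 1)` are glued along `A k`. -/
def successiveGluing (hf : ∀ n, Isometry (f n)) (hg : ∀ n, Isometry (g n)) :
    ∀ n, MetricExtension (Z n)
  | 0 => ⟨Z 0, id, isometry_id⟩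
  | n + 1 =>
    let Y := successiveGluing hf hg n
    ⟨GlueSpace (Y.isometry_embed.comp (hf n)) (hg n), toGlueR _ _, toGlueR_isometry _ _⟩

theorem exists_completeSpace_comp_eq_comp (hf : ∀ n, Isometry (f n)) (hg : ∀ n, Isometry (g n)) :
    ∃ (W : Type u) (_ : MetricSpace W) (_ : CompleteSpace W) (k : ∀ n, Z n → W),
      (∀ n, Isometry (k n)) ∧ ∀ n, k n ∘ f n = k (n + 1) ∘ g n := by
  let Y := successiveGluing hf hg
  have hYf : ∀ n, Isometry ((Y n).embed ∘ f n) := fun n => (Y n).isometry_embed.comp (hf n)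
  let l : ∀ n, (Y n).carrier → (Y (n + 1)).carrier := fun n => toGlueL (hYf n) (hg n)
  have hl : ∀ n, Isometry (l n) := fun n => toGlueL_isometry (hYf n) (hg n)
  have hlg : ∀ n, l n ∘ (Y n).embed ∘ f n = (Y (n + 1)).embed ∘ g n := fun n =>
    toGlue_commute (hYf n) (hg n)
  let j : InductiveLimit hl → UniformSpace.Completion (InductiveLimit hl) := (↑)
  refine ⟨_, _, inferInstance, fun n => j ∘ toInductiveLimit hl n ∘ (Y n).embed, fun n =>
    UniformSpace.Completion.coe_isometry.comp
      ((toInductiveLimit_isometry hl n).comp (Y n).isometry_embed), fun n => ?_⟩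
  calc j ∘ toInductiveLimit hl n ∘ (Y n).embed ∘ f n
      = j ∘ toInductiveLimit hl (n + 1) ∘ l n ∘ (Y n).embed ∘ f n := by
        rw [← toInductiveLimit_commute hl n]; rfl
    _ = j ∘ toInductiveLimit hl (n + 1) ∘ (Y (n + 1)).embed ∘ g n := by rw [hlg]

end SuccessiveGluing

section Completeness

theorem exists_nonemptyCompacts_forall_subset_of_cauchySeq {α : Type*} [MetricSpace α]
    [CompleteSpace α] {K : ℕ → NonemptyCompacts α} (hK : CauchySeq K) :
    ∃ S : NonemptyCompacts α, ∀ n, (K n : Set α) ⊆ S := by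
  obtain ⟨L, hL⟩ := cauchySeq_tendsto_of_complete hK
  have hKS : ∀ n, (K n : Set α) ⊆ ⋃ K' ∈ insert L (range K), (K' : Set α) := fun n =>
    subset_biUnion_of_mem (u := fun K' : NonemptyCompacts α => (K' : Set α))
      (mem_insert_of_mem _ (mem_range_self n))
  exact ⟨⟨⟨_, NonemptyCompacts.isCompact_biUnion_coe_of_isCompact hL.isCompact_insert_range⟩,
    (K 0).nonempty.mono (hKS 0)⟩, hKS⟩

/-- A nonempty compact set as an object of the category of compact metric spaces. -/
def CompObj.ofNonemptyCompacts {α : Type u} [MetricSpace α] (K : NonemptyCompacts α) :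
    CompObj.{u} :=
  have := isCompact_iff_compactSpace.1 K.isCompact
  have := K.nonempty.to_subtype
  ⟨(K : Set α)⟩

theorem CompObj.isometry_val {α : Type u} [MetricSpace α] (K : NonemptyCompacts α) :
    Isometry (Subtype.val : CompObj.ofNonemptyCompacts K → α) :=
  isometry_subtype_coe

/-- A coupling is tight if its space is covered by the images of the two coupled spaces. -/
def Coupling.IsTight {X Y : CompObj.{u}} (c : Coupling X Y) : Prop :=
  range c.inl ∪ range c.inr = univ

variable {τ : CompFunctor.{u, w}}

theorem exists_isTight_cost_eq (P Q : Structured τ) (c : Coupling P.space Q.space) :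
    ∃ d : Coupling P.space Q.space, d.IsTight ∧ d.cost P Q = c.cost P Q := by
  let K : NonemptyCompacts c.space :=
    rangeCompacts c.isometry_inl.continuous ⊔ rangeCompacts c.isometry_inr.continuous
  let d : Coupling P.space Q.space :=
    { space := CompObj.ofNonemptyCompacts K
      inl := fun x => ⟨c.inl x, Or.inl ⟨x, rfl⟩⟩
      inr := fun y => ⟨c.inr y, Or.inr ⟨y, rfl⟩⟩
      isometry_inl := c.isometry_inl
      isometry_inr := c.isometry_inr }
  refine ⟨d, eq_univ_of_forall ?_,
    (P.dist_place_comp Q d.isometry_inl d.isometry_inr (CompObj.isometry_val K)).symm⟩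
  rintro ⟨_, ⟨x, rfl⟩ | ⟨y, rfl⟩⟩
  exacts [Or.inl ⟨x, rfl⟩, Or.inr ⟨y, rfl⟩]

theorem dist_rangeCompacts_inl_inr_le_cost (P Q : Structured τ) (c : Coupling P.space Q.space) :
    dist (rangeCompacts c.isometry_inl.continuous) (rangeCompacts c.isometry_inr.continuous) ≤
      c.cost P Q :=
  le_max_left _ _

theorem Coupling.IsTight.exists_dist_inl_le {P Q : Structured τ} {c : Coupling P.space Q.space}
    (hc : c.IsTight) (z : c.space) : ∃ x, dist (c.inl x) z ≤ c.cost P Q := by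
  obtain ⟨x, rfl⟩ | ⟨y, rfl⟩ := hc.ge (mem_univ z)
  · exact ⟨x, (dist_self _).trans_le dist_nonneg⟩
  · exact (dist_rangeCompacts_le_iff.1 (dist_rangeCompacts_inl_inr_le_cost P Q c)).2 y

theorem Coupling.IsTight.exists_dist_inr_le {P Q : Structured τ} {c : Coupling P.space Q.space}
    (hc : c.IsTight) (z : c.space) : ∃ y, dist z (c.inr y) ≤ c.cost P Q := by
  obtain ⟨x, rfl⟩ | ⟨y, rfl⟩ := hc.ge (mem_univ z)
  · exact (dist_rangeCompacts_le_iff.1 (dist_rangeCompacts_inl_inr_le_cost P Q c)).1 x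
  · exact ⟨y, (dist_self _).trans_le dist_nonneg⟩

theorem dist_rangeCompacts_le_of_isTight {P Q R : Structured τ} {c : Coupling P.space Q.space}
    {d : Coupling Q.space R.space} (hc : c.IsTight) (hd : d.IsTight) {α : Type*} [MetricSpace α]
    {k : c.space → α} {l : d.space → α} (hk : Isometry k) (hl : Isometry l)
    (h : k ∘ c.inr = l ∘ d.inl) {r : ℝ} (hcr : c.cost P Q ≤ r) (hdr : d.cost Q R ≤ r) :
    dist (rangeCompacts hk.continuous) (rangeCompacts hl.continuous) ≤ r := by
  refine dist_rangeCompacts_le_iff.2 ⟨fun z => ?_, fun z => ?_⟩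
  · obtain ⟨y, hy⟩ := hc.exists_dist_inr_le z
    refine ⟨d.inl y, ?_⟩
    rw [← Function.comp_apply (f := l), ← h]
    exact (hk.dist_eq _ _).trans_le (hy.trans hcr)
  · obtain ⟨y, hy⟩ := hd.exists_dist_inl_le z
    refine ⟨c.inr y, ?_⟩
    rw [← Function.comp_apply (f := k), h]
    exact (hl.dist_eq _ _).trans_le (hy.trans hdr)

theorem exists_isometry_dist_place_le (P : ℕ → Structured τ)
    (h : ∀ n, ghfDist τ ⟦P n⟧ ⟦P (n + 1)⟧ < (1 / 2) ^ n) :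
    ∃ (S : CompObj.{u}) (i : ∀ n, (P n).space → S) (hi : ∀ n, Isometry (i n)),
      ∀ n, dist ((P n).place (hi n)) ((P (n + 1)).place (hi (n + 1))) ≤ (1 / 2) ^ n := by
  have : ∀ n, ∃ c : Coupling (P n).space (P (n + 1)).space, c.IsTight ∧
      c.cost (P n) (P (n + 1)) < (1 / 2) ^ n := fun n => by
    obtain ⟨c, hc⟩ := (ghfDist_lt_iff _ _).1 (h n)
    obtain ⟨d, hd, hdc⟩ := exists_isTight_cost_eq _ _ c
    exact ⟨d, hd, hdc.trans_lt hc⟩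
  choose c hc hcost using this
  obtain ⟨W, _, _, k, hk, hkc⟩ := exists_completeSpace_comp_eq_comp
    (fun n => (c n).isometry_inr) fun n => (c (n + 1)).isometry_inl
  have hcauchy : CauchySeq fun n => rangeCompacts (hk n).continuous := by
    refine cauchySeq_of_le_geometric (1 / 2) 1 (by norm_num) fun n => ?_
    refine (dist_rangeCompacts_le_of_isTight (hc n) (hc (n + 1)) (hk n) (hk (n + 1)) (hkc n)
      (hcost n).le ((hcost (n + 1)).le.trans ?_)).trans_eq (one_mul _).symm
    exact pow_le_pow_of_le_one (by norm_num) (by norm_num) n.le_succ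
  obtain ⟨S, hS⟩ := exists_nonemptyCompacts_forall_subset_of_cauchySeq hcauchy
  let k' : ∀ n, (c n).space → CompObj.ofNonemptyCompacts S := fun n z => ⟨k n z, hS n ⟨z, rfl⟩⟩
  have hk' : ∀ n, Isometry (k' n) := hk
  refine ⟨_, fun n => k' n ∘ (c n).inl, fun n => (hk' n).comp (c n).isometry_inl, fun n => ?_⟩
  have hglue : k' n ∘ (c n).inr = k' (n + 1) ∘ (c (n + 1)).inl :=
    funext fun y => Subtype.ext (congrFun (hkc n) y)
  rw [← (P (n + 1)).place_congr hglue ((hk' n).comp (c n).isometry_inr),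
    (P n).dist_place_comp (P (n + 1)) (c n).isometry_inl (c n).isometry_inr (hk' n)]
  exact (hcost n).le

theorem ghfDist_le_dist_place (P Q : Structured τ) {Z : CompObj.{u}} {f : P.space → Z}
    {g : Q.space → Z} (hf : Isometry f) (hg : Isometry g) :
    ghfDist τ ⟦P⟧ ⟦Q⟧ ≤ dist (P.place hf) (Q.place hg) :=
  ghfDist_le_cost P Q ⟨Z, f, g, hf, hg⟩

theorem exists_place_eq_of_tendsto [τ.IsHausdorffNonexpansive] [∀ X, CompleteSpace (τ.obj X)]
    {ι : Type*} {l : Filter ι} [l.NeBot] {P : ι → Structured τ} {Z : CompObj.{u}}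
    {f : ∀ i, (P i).space → Z} (hf : ∀ i, Isometry (f i)) {s : NonemptyCompacts Z × τ.obj Z}
    (h : Tendsto (fun i => (P i).place (hf i)) l (𝓝 s)) :
    ∃ (Q : Structured τ) (g : Q.space → Z) (hg : Isometry g), Q.place hg = s := by
  obtain ⟨K, a⟩ := s
  let g : CompObj.ofNonemptyCompacts K → Z := Subtype.val
  have hg : Isometry g := CompObj.isometry_val K
  have hgK : rangeCompacts hg.continuous = K := NonemptyCompacts.ext Subtype.range_coe
  suffices a ∈ range (τ.map g hg) by
    obtain ⟨b, rfl⟩ := this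
    exact ⟨⟨_, b⟩, g, hg, Prod.ext hgK rfl⟩
  rw [← (τ.isometry_map g hg).isClosedEmbedding.isClosed_range.closure_eq, mem_closure_range_iff]
  intro ε hε
  obtain ⟨i, hi⟩ := ((tendsto_iff_dist_tendsto_zero.1 h).eventually_lt_const (half_pos hε)).exists
  obtain ⟨hiK, hia⟩ := max_lt_iff.1 hi
  have hfg : dist (rangeCompacts (hf i).continuous) (rangeCompacts hg.continuous) ≤ ε / 2 := by
    rw [hgK]
    exact hiK.le
  obtain ⟨b, hb⟩ := CompFunctor.IsHausdorffNonexpansive.exists_dist_map_le (hf i) hg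
    (dist_rangeCompacts_le_iff.1 hfg).1 (P i).str
  exact ⟨b, (dist_triangle_left _ _ _).trans_lt ((add_lt_add_of_lt_of_le hia hb).trans_eq
    (add_halves ε))⟩

instance [τ.IsNonexpansive] [τ.IsHausdorffNonexpansive] [∀ X, CompleteSpace (τ.obj X)] :
    CompleteSpace (CSpace τ) := by
  refine complete_of_convergent_controlled_sequences (fun n => (1 / 2 : ℝ) ^ n)
    (fun n => by positivity) fun p hp => ?_
  choose P hP using fun n => Quotient.exists_rep (p n)
  obtain ⟨S, i, hi, hdist⟩ := exists_isometry_dist_place_le P fun n => by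
    rw [hP, hP]
    exact hp n n (n + 1) le_rfl n.le_succ
  have hcauchy : CauchySeq fun n => (P n).place (hi n) :=
    cauchySeq_of_le_geometric (1 / 2) 1 (by norm_num) fun n => (hdist n).trans_eq (one_mul _).symm
  obtain ⟨s, hs⟩ := cauchySeq_tendsto_of_complete hcauchy
  obtain ⟨Q, g, hg, rfl⟩ := exists_place_eq_of_tendsto hi hs
  refine ⟨⟦Q⟧, tendsto_iff_dist_tendsto_zero.2 (squeeze_zero (fun _ => dist_nonneg) (fun n => ?_)
    (tendsto_iff_dist_tendsto_zero.1 hs))⟩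
  rw [← hP n]
  exact ghfDist_le_dist_place (P n) Q (hi n) hg

end Completeness

/-! ### Separability -/

section Separability

theorem separableSpace_of_antilipschitzWith {α β : Type*} [MetricSpace α] [PseudoMetricSpace β]
    [SeparableSpace β] {K : NNReal} {f : α → β} (hf : AntilipschitzWith K f) :
    SeparableSpace α := by
  have := UniformSpace.secondCountable_of_separable β
  let e := Equiv.ofInjective f hf.injective
  have he : AntilipschitzWith K e := fun x y => hf x y
  exact e.symm.surjective.denseRange.separableSpace (he.to_rightInverse e.right_inv).continuous

/-- The cube `[0, M]^n` with the maximum metric. -/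
def cube (n M : ℕ) : CompObj.{u} :=
  have : Nonempty (Icc (0 : ℝ) M) := ⟨⟨0, le_rfl, M.cast_nonneg⟩⟩
  ⟨ULift.{u} (Fin n → Icc (0 : ℝ) M)⟩

theorem exists_isometry_cube (X : Type*) [MetricSpace X] [Finite X] :
    ∃ (n M : ℕ) (f : X → cube.{u} n M), Isometry f := by
  obtain ⟨n, ⟨s⟩⟩ := Finite.exists_equiv_fin X
  obtain ⟨M, hM⟩ := exists_nat_ge (diam (univ : Set X))
  have hdist : ∀ x y : X, dist x y ≤ M := fun x y =>
    (dist_le_diam_of_mem finite_univ.isBounded (mem_univ x) (mem_univ y)).trans hM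
  refine ⟨n, M, fun x => ⟨fun i => ⟨dist x (s.symm i), dist_nonneg, hdist _ _⟩⟩,
    Isometry.of_dist_eq fun x y => le_antisymm ?_ ?_⟩
  · exact (dist_pi_le_iff dist_nonneg).2 fun i => abs_dist_sub_le _ _ _
  · refine le_trans ?_ (dist_le_pi_dist _ _ (s y))
    change _ ≤ |dist x (s.symm (s y)) - dist y (s.symm (s y))|
    simp

variable {τ : CompFunctor.{u, w}}

theorem exists_finite_ghfDist_le [τ.IsHausdorffNonexpansive] (P : Structured τ) {ε : ℝ}
    (hε : 0 < ε) : ∃ Q : Structured τ, Finite Q.space ∧ ghfDist τ ⟦P⟧ ⟦Q⟧ ≤ ε := by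
  obtain ⟨t, -, ht, htP⟩ := finite_cover_balls_of_compact (isCompact_univ (X := P.space)) hε
  have hnear : ∀ x, ∃ y ∈ t, dist x y ≤ ε := fun x =>
    let ⟨y, hy, hxy⟩ := mem_iUnion₂.1 (htP (mem_univ x))
    ⟨y, hy, (mem_ball.1 hxy).le⟩
  obtain ⟨y, hy, -⟩ := hnear (Classical.arbitrary _)
  let K : NonemptyCompacts P.space := ⟨⟨t, ht.isCompact⟩, y, hy⟩
  let g : CompObj.ofNonemptyCompacts K → P.space := Subtype.val
  have hg : Isometry g := CompObj.isometry_val K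
  have hnear' : ∀ x, ∃ y, dist (id x) (g y) ≤ ε := fun x =>
    let ⟨y, hy, hxy⟩ := hnear x
    ⟨⟨y, hy⟩, hxy⟩
  obtain ⟨b, hb⟩ := CompFunctor.IsHausdorffNonexpansive.exists_dist_map_le isometry_id hg
    hnear' P.str
  have hrange : dist (rangeCompacts isometry_id.continuous) (rangeCompacts hg.continuous) ≤ ε :=
    dist_rangeCompacts_le_iff.2 ⟨hnear', fun y => ⟨g y, (dist_self _).trans_le hε.le⟩⟩
  exact ⟨⟨_, b⟩, ht.to_subtype,
    (ghfDist_le_dist_place P ⟨_, b⟩ isometry_id hg).trans (max_le hrange hb)⟩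

theorem isSeparable_setOf_isometry [τ.IsNonexpansive] (Z : CompObj.{u})
    [SeparableSpace (τ.obj Z)] :
    IsSeparable {p : CSpace τ | ∃ (P : Structured τ) (f : P.space → Z), Isometry f ∧ ⟦P⟧ = p} := by
  choose P f hf hP using fun p : {p : CSpace τ |
    ∃ (P : Structured τ) (f : P.space → Z), Isometry f ∧ ⟦P⟧ = p} => p.2
  have hanti : AntilipschitzWith 1 fun p => (P p).place (hf p) :=
    AntilipschitzWith.of_le_mul_dist fun p q => by
      rw [NNReal.coe_one, one_mul, Subtype.dist_eq, ← hP p, ← hP q]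
      exact ghfDist_le_dist_place _ _ (hf p) (hf q)
  have := separableSpace_of_antilipschitzWith hanti
  exact .of_subtype _

instance [τ.IsNonexpansive] [τ.IsHausdorffNonexpansive] [∀ X, SeparableSpace (τ.obj X)] :
    SeparableSpace (CSpace τ) := by
  refine isSeparable_univ_iff.1 (((IsSeparable.iUnion fun n => .iUnion fun M =>
    isSeparable_setOf_isometry (cube n M)).closure).mono fun p _ => ?_)
  obtain ⟨P, rfl⟩ := Quotient.exists_rep p
  refine Metric.mem_closure_iff.2 fun ε hε => ?_
  obtain ⟨Q, _, hPQ⟩ := exists_finite_ghfDist_le P (half_pos hε)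
  obtain ⟨n, M, f, hf⟩ := exists_isometry_cube.{u} Q.space
  exact ⟨⟦Q⟧, mem_iUnion₂.2 ⟨n, M, Q, f, hf, rfl⟩, hPQ.trans_lt (half_lt_self hε)⟩

end Separability

/-! ### Points, marked compact sets, and pairs -/

section Functors

instance : pointFunctor.{u}.IsNonexpansive where
  dist_map_le _ _ a _ h := h a

instance : pointFunctor.{u}.IsHausdorffNonexpansive where
  exists_dist_map_le _ _ _ h := h

instance (X : CompObj.{u}) : CompleteSpace (pointFunctor.obj X) :=
  inferInstanceAs (CompleteSpace X)

instance (X : CompObj.{u}) : SeparableSpace (pointFunctor.obj X) :=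
  inferInstanceAs (SeparableSpace X)

section Prod

variable {τ₁ : CompFunctor.{u, v}} {τ₂ : CompFunctor.{u, w}}

instance [τ₁.IsNonexpansive] [τ₂.IsNonexpansive] : (prodFunctor τ₁ τ₂).IsNonexpansive where
  dist_map_le hf hg a _ h :=
    max_le (CompFunctor.IsNonexpansive.dist_map_le hf hg a.1 h)
      (CompFunctor.IsNonexpansive.dist_map_le hf hg a.2 h)

instance [τ₁.IsHausdorffNonexpansive] [τ₂.IsHausdorffNonexpansive] :
    (prodFunctor τ₁ τ₂).IsHausdorffNonexpansive where
  exists_dist_map_le hf hg _ h a :=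
    let ⟨b₁, h₁⟩ := CompFunctor.IsHausdorffNonexpansive.exists_dist_map_le hf hg h a.1
    let ⟨b₂, h₂⟩ := CompFunctor.IsHausdorffNonexpansive.exists_dist_map_le hf hg h a.2
    ⟨(b₁, b₂), max_le h₁ h₂⟩

instance (X : CompObj.{u}) [CompleteSpace (τ₁.obj X)] [CompleteSpace (τ₂.obj X)] :
    CompleteSpace ((prodFunctor τ₁ τ₂).obj X) :=
  inferInstanceAs (CompleteSpace (τ₁.obj X × τ₂.obj X))

instance (X : CompObj.{u}) [SeparableSpace (τ₁.obj X)] [SeparableSpace (τ₂.obj X)] :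
    SeparableSpace ((prodFunctor τ₁ τ₂).obj X) :=
  inferInstanceAs (SeparableSpace (τ₁.obj X × τ₂.obj X))

end Prod

variable {Ξ : Type v} [MetricSpace Ξ]

theorem dist_markedFunctor_map_le_iff {X Y Z : CompObj.{u}} {f : X → Z} {g : Y → Z}
    (hf : Isometry f) (hg : Isometry g) {K : NonemptyCompacts (X × Ξ)}
    {L : NonemptyCompacts (Y × Ξ)} {r : ℝ} :
    dist ((markedFunctor.{u, v} Ξ).map f hf K) ((markedFunctor.{u, v} Ξ).map g hg L) ≤ r ↔
      (∀ p ∈ K, ∃ q ∈ L, dist (f p.1) (g q.1) ≤ r ∧ dist p.2 q.2 ≤ r) ∧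
        ∀ q ∈ L, ∃ p ∈ K, dist (f p.1) (g q.1) ≤ r ∧ dist p.2 q.2 ≤ r := by
  simp only [← max_le_iff]
  exact (dist_nonemptyCompacts_le_iff (α := Z × Ξ)).trans <| and_congr
    (forall_mem_image.trans <| forall₂_congr fun _ _ => exists_mem_image)
    (forall_mem_image.trans <| forall₂_congr fun _ _ => exists_mem_image)

instance : (markedFunctor.{u, v} Ξ).IsNonexpansive where
  dist_map_le hf hg K r h :=
    have hr : 0 ≤ r := dist_nonneg.trans (h (Classical.arbitrary _))
    (dist_markedFunctor_map_le_iff hf hg (K := K) (L := K)).2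
      ⟨fun p hp => ⟨p, hp, h p.1, (dist_self _).trans_le hr⟩,
        fun q hq => ⟨q, hq, h q.1, (dist_self _).trans_le hr⟩⟩

theorem exists_nonemptyCompacts_dist_fst_le {X Y Z M : Type*} [TopologicalSpace X]
    [TopologicalSpace Y] [CompactSpace Y] [PseudoMetricSpace Z] [TopologicalSpace M] {f : X → Z}
    {g : Y → Z} (hf : Continuous f) (hg : Continuous g) {r : ℝ}
    (h : ∀ x, ∃ y, dist (f x) (g y) ≤ r) (K : NonemptyCompacts (X × M)) :
    ∃ L : NonemptyCompacts (Y × M), (∀ p ∈ K, ∃ y, (y, p.2) ∈ L ∧ dist (f p.1) (g y) ≤ r) ∧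
      ∀ q ∈ L, ∃ x, (x, q.2) ∈ K ∧ dist (f x) (g q.1) ≤ r := by
  let S : Set (Y × X × M) := univ ×ˢ (K : Set (X × M)) ∩ {s | dist (f s.2.1) (g s.1) ≤ r}
  have hS : IsCompact S :=
    (isCompact_univ.prod K.isCompact).inter_right (isClosed_le (by fun_prop) continuous_const)
  have hKS : ∀ p ∈ K, ∃ y, (y, p) ∈ S := fun p hp =>
    let ⟨y, hy⟩ := h p.1
    ⟨y, ⟨mem_univ _, hp⟩, hy⟩
  let φ : Y × X × M → Y × M := fun s => (s.1, s.2.2)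
  have hφ : Continuous φ := by fun_prop
  obtain ⟨p, hp⟩ := K.nonempty
  obtain ⟨y, hy⟩ := hKS p hp
  refine ⟨⟨⟨φ '' S, hS.image hφ⟩, _, mem_image_of_mem φ hy⟩, fun p hp => ?_, ?_⟩
  · obtain ⟨y, hy⟩ := hKS p hp
    exact ⟨y, mem_image_of_mem φ hy, hy.2⟩
  · rintro _ ⟨⟨y, x, ξ⟩, ⟨⟨-, hK⟩, hd⟩, rfl⟩
    exact ⟨x, hK, hd⟩

instance : (markedFunctor.{u, v} Ξ).IsHausdorffNonexpansive where
  exists_dist_map_le {X Y Z f g} hf hg r h (K : NonemptyCompacts (X × Ξ)) := by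
    have hr : 0 ≤ r := let ⟨_, hy⟩ := h (Classical.arbitrary _); dist_nonneg.trans hy
    obtain ⟨L, hKL, hLK⟩ := exists_nonemptyCompacts_dist_fst_le hf.continuous hg.continuous h K
    refine ⟨L, (dist_markedFunctor_map_le_iff hf hg).2 ⟨fun p hp => ?_, fun q hq => ?_⟩⟩
    · obtain ⟨y, hy, hd⟩ := hKL p hp
      exact ⟨_, hy, hd, (dist_self _).trans_le hr⟩
    · obtain ⟨x, hx, hd⟩ := hLK q hq
      exact ⟨_, hx, hd, (dist_self _).trans_le hr⟩

instance [CompleteSpace Ξ] (X : CompObj.{u}) :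
    CompleteSpace ((markedFunctor.{u, v} Ξ).obj X) :=
  inferInstanceAs (CompleteSpace (NonemptyCompacts (X × Ξ)))

instance [SeparableSpace Ξ] (X : CompObj.{u}) :
    SeparableSpace ((markedFunctor.{u, v} Ξ).obj X) :=
  inferInstanceAs (SeparableSpace (NonemptyCompacts (X × Ξ)))

instance : (pointedMarkedFunctor.{u, v} Ξ).IsNonexpansive :=
  inferInstanceAs (prodFunctor pointFunctor (markedFunctor Ξ)).IsNonexpansive

instance : (pointedMarkedFunctor.{u, v} Ξ).IsHausdorffNonexpansive :=
  inferInstanceAs (prodFunctor pointFunctor (markedFunctor Ξ)).IsHausdorffNonexpansive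

instance [CompleteSpace Ξ] (X : CompObj.{u}) :
    CompleteSpace ((pointedMarkedFunctor.{u, v} Ξ).obj X) :=
  inferInstanceAs (CompleteSpace ((prodFunctor pointFunctor (markedFunctor Ξ)).obj X))

instance [SeparableSpace Ξ] (X : CompObj.{u}) :
    SeparableSpace ((pointedMarkedFunctor.{u, v} Ξ).obj X) :=
  inferInstanceAs (SeparableSpace ((prodFunctor pointFunctor (markedFunctor Ξ)).obj X))

end Functors

/-! ### Correspondences -/

section Correspondence

variable {Ξ : Type v} [MetricSpace Ξ]

theorem isCorrespondence_iff {X Y : Type*} {R : Set (X × Y)} :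
    IsCorrespondence R ↔ (∀ x, ∃ y, (x, y) ∈ R) ∧ ∀ y, ∃ x, (x, y) ∈ R := by
  simp [IsCorrespondence, eq_univ_iff_forall]

theorem isCorrespondence_univ (X Y : Type*) [Nonempty X] [Nonempty Y] :
    IsCorrespondence (univ : Set (X × Y)) :=
  isCorrespondence_iff.2 (by simp)

theorem IsCorrespondence.mono {X Y : Type*} {R S : Set (X × Y)} (hR : IsCorrespondence R)
    (h : R ⊆ S) : IsCorrespondence S := by
  rw [isCorrespondence_iff] at hR ⊢
  exact ⟨fun x => (hR.1 x).imp fun _ hy => h hy, fun y => (hR.2 y).imp fun _ hx => h hx⟩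

theorem IsCorrespondence.nonempty {X Y : Type*} [Nonempty X] {R : Set (X × Y)}
    (hR : IsCorrespondence R) : R.Nonempty :=
  let ⟨_, hy⟩ := (isCorrespondence_iff.1 hR).1 (Classical.arbitrary X)
  ⟨_, hy⟩

theorem correspondenceCost_nonneg {X Y : Type*} [MetricSpace X] [MetricSpace Y] (φ : X → Ξ)
    (ψ : Y → Ξ) (R : Set (X × Y)) : 0 ≤ correspondenceCost φ ψ R := by
  refine le_max_of_le_right (Real.sSup_nonneg ?_)
  rintro _ ⟨p, -, rfl⟩
  exact dist_nonneg

theorem distortion_le_iff {X Y : Type*} [MetricSpace X] [CompactSpace X] [MetricSpace Y]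
    [CompactSpace Y] {R : Set (X × Y)} (hR : R.Nonempty) {r : ℝ} :
    distortion R ≤ r ↔ ∀ p ∈ R, ∀ q ∈ R, |dist p.1 q.1 - dist p.2 q.2| ≤ r := by
  have hbdd : BddAbove {r : ℝ | ∃ p ∈ R, ∃ q ∈ R, r = |dist p.1 q.1 - dist p.2 q.2|} := by
    refine (isCompact_range (f := fun z : (X × Y) × (X × Y) =>
      |dist z.1.1 z.2.1 - dist z.1.2 z.2.2|) (by fun_prop)).bddAbove.mono ?_
    rintro _ ⟨p, -, q, -, rfl⟩
    exact ⟨(p, q), rfl⟩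
  obtain ⟨p, hp⟩ := hR
  refine (csSup_le_iff hbdd ⟨_, p, hp, p, hp, rfl⟩).trans ⟨fun h p hp q hq =>
    h _ ⟨p, hp, q, hq, rfl⟩, ?_⟩
  rintro h _ ⟨p, hp, q, hq, rfl⟩
  exact h p hp q hq

theorem correspondenceCost_le_iff {X Y : Type*} [MetricSpace X] [CompactSpace X] [MetricSpace Y]
    [CompactSpace Y] (φ : C(X, Ξ)) (ψ : C(Y, Ξ)) {R : Set (X × Y)} (hR : R.Nonempty) {r : ℝ} :
    correspondenceCost φ ψ R ≤ r ↔
      (∀ p ∈ R, ∀ q ∈ R, |dist p.1 q.1 - dist p.2 q.2| ≤ 2 * r) ∧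
        ∀ p ∈ R, dist (φ p.1) (ψ p.2) ≤ r := by
  have hbdd : BddAbove {r : ℝ | ∃ p ∈ R, r = dist (φ p.1) (ψ p.2)} := by
    refine (isCompact_range (f := fun z : X × Y => dist (φ z.1) (ψ z.2))
      (by fun_prop)).bddAbove.mono ?_
    rintro _ ⟨p, -, rfl⟩
    exact ⟨p, rfl⟩
  have hne : {r : ℝ | ∃ p ∈ R, r = dist (φ p.1) (ψ p.2)}.Nonempty :=
    let ⟨p, hp⟩ := hR
    ⟨_, p, hp, rfl⟩
  refine max_le_iff.trans (and_congr ?_ ((csSup_le_iff hbdd hne).trans ⟨fun h p hp =>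
    h _ ⟨p, hp, rfl⟩, ?_⟩))
  · rw [← distortion_le_iff hR, one_div, inv_mul_le_iff₀ two_pos]
  · rintro h _ ⟨p, hp, rfl⟩
    exact h p hp

/-- The pairs of points which are at distance at most `r` in a coupling and have marks at distance
at most `r`. -/
def Coupling.closePairs {X Y : CompObj.{u}} (c : Coupling X Y) (φ : X → Ξ) (ψ : Y → Ξ) (r : ℝ) :
    Set (X × Y) :=
  {p | dist (c.inl p.1) (c.inr p.2) ≤ r ∧ dist (φ p.1) (ψ p.2) ≤ r}

theorem Coupling.correspondenceCost_closePairs_le {X Y : CompObj.{u}} (c : Coupling X Y)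
    (φ : C(X, Ξ)) (ψ : C(Y, Ξ)) {r : ℝ} (h : (c.closePairs φ ψ r).Nonempty) :
    correspondenceCost φ ψ (c.closePairs φ ψ r) ≤ r := by
  refine (correspondenceCost_le_iff φ ψ h).2 ⟨fun p hp q hq => ?_, fun p hp => hp.2⟩
  rw [← c.isometry_inl.dist_eq, ← c.isometry_inr.dist_eq, ← Real.dist_eq]
  exact (dist_dist_dist_le _ _ _ _).trans (by linarith [hp.1, hq.1])

theorem exists_subset_closePairs_of_correspondenceCost_lt {X Y : CompObj.{u}} (φ : C(X, Ξ))
    (ψ : C(Y, Ξ)) {R : Set (X × Y)} (hR : R.Nonempty) {r : ℝ}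
    (h : correspondenceCost φ ψ R < r) :
    ∃ c : Coupling X Y, ∃ s < r, R ⊆ c.closePairs φ ψ s := by
  obtain ⟨s, hRs, hsr⟩ := exists_between h
  obtain ⟨hdist, hfunc⟩ := (correspondenceCost_le_iff φ ψ hR).1 hRs.le
  have := hR.to_subtype
  obtain ⟨c, hc⟩ := exists_coupling_of_distortion_le (fun p : R => p.1.1) (fun p : R => p.1.2)
    ((correspondenceCost_nonneg _ _ _).trans_lt hRs) fun p q => hdist p p.2 q q.2
  exact ⟨c, s, hsr, fun p hp => ⟨(hc ⟨p, hp⟩).le, hfunc p hp⟩⟩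

/-- The set `𝓡` stands for the set of all correspondences, or of those that contain the pair of the
two roots. -/
theorem exists_correspondenceCost_lt_iff {X Y : CompObj.{u}} (φ : C(X, Ξ)) (ψ : C(Y, Ξ))
    {𝓡 : Set (Set (X × Y))} (h𝓡 : IsUpperSet 𝓡) (hne : ∀ R ∈ 𝓡, R.Nonempty) {r : ℝ} :
    (∃ R ∈ 𝓡, correspondenceCost φ ψ R < r) ↔
      ∃ c : Coupling X Y, ∃ s < r, c.closePairs φ ψ s ∈ 𝓡 := by
  constructor
  · rintro ⟨R, hR, h⟩
    obtain ⟨c, s, hs, hRs⟩ := exists_subset_closePairs_of_correspondenceCost_lt φ ψ (hne R hR) h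
    exact ⟨c, s, hs, h𝓡 hRs hR⟩
  · rintro ⟨c, s, hs, hc⟩
    exact ⟨_, hc, (c.correspondenceCost_closePairs_le φ ψ (hne _ hc)).trans_lt hs⟩

end Correspondence

/-! ### Spaces with a continuous function -/

section FunctionSpace

variable {Ξ : Type v} [MetricSpace Ξ]

/-- The representative `(X, gr_φ)` of the image of `(X, φ)` in `𝒞_τ`. -/
abbrev FunctionSpace.graph (P : FunctionSpace.{u, v} Ξ) : Structured (markedFunctor.{u, v} Ξ) :=
  ⟨P.space, graphCompact P.space P.func⟩

theorem cost_graph_le_iff (P Q : FunctionSpace.{u, v} Ξ) (c : Coupling P.space Q.space) {r : ℝ} :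
    c.cost P.graph Q.graph ≤ r ↔ IsCorrespondence (c.closePairs P.func Q.func r) := by
  have hgraph : dist ((markedFunctor Ξ).map c.inl c.isometry_inl P.graph.str)
      ((markedFunctor Ξ).map c.inr c.isometry_inr Q.graph.str) ≤ r ↔
        IsCorrespondence (c.closePairs P.func Q.func r) := by
    rw [isCorrespondence_iff]
    exact (dist_markedFunctor_map_le_iff c.isometry_inl c.isometry_inr
      (K := graphCompact P.space P.func) (L := graphCompact Q.space Q.func)).trans <| and_congr
        (forall_mem_range.trans <| forall_congr' fun _ => exists_range_iff)
        (forall_mem_range.trans <| forall_congr' fun _ => exists_range_iff)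
  refine ⟨fun h => hgraph.1 ((le_max_right _ _).trans h), fun h => max_le ?_ (hgraph.2 h)⟩
  obtain ⟨hl, hr⟩ := isCorrespondence_iff.1 h
  exact (dist_rangeCompacts_le_iff (hf := c.isometry_inl.continuous)
    (hg := c.isometry_inr.continuous)).2
    ⟨fun x => (hl x).imp fun _ => And.left, fun y => (hr y).imp fun _ => And.left⟩

theorem tDist_lt_iff (p q : TSpace.{u, v} Ξ) {r : ℝ} :
    tDist p q < r ↔ ∃ P Q : FunctionSpace.{u, v} Ξ, (⟦P⟧ : TSpace Ξ) = p ∧ (⟦Q⟧ : TSpace Ξ) = q ∧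
      ∃ R : Set (P.space × Q.space), IsCorrespondence R ∧
        correspondenceCost P.func Q.func R < r := by
  obtain ⟨P, hP⟩ := Quotient.exists_rep p
  obtain ⟨Q, hQ⟩ := Quotient.exists_rep q
  constructor
  · intro h
    obtain ⟨_, ⟨P, Q, hP, hQ, R, hR, rfl⟩, h⟩ := exists_lt_of_csInf_lt
      (by exact ⟨_, P, Q, hP, hQ, univ, isCorrespondence_univ _ _, rfl⟩) h
    exact ⟨P, Q, hP, hQ, R, hR, h⟩
  · rintro ⟨P, Q, hP, hQ, R, hR, h⟩
    refine csInf_lt_of_lt ⟨0, ?_⟩ ⟨P, Q, hP, hQ, R, hR, rfl⟩ h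
    rintro _ ⟨_, _, _, _, _, _, rfl⟩
    exact correspondenceCost_nonneg _ _ _

theorem ghfDist_graph_lt_iff (P Q : FunctionSpace.{u, v} Ξ) {r : ℝ} :
    ghfDist _ ⟦P.graph⟧ ⟦Q.graph⟧ < r ↔ ∃ R : Set (P.space × Q.space), IsCorrespondence R ∧
      correspondenceCost P.func Q.func R < r :=
  (ghfDist_lt_iff_exists_le P.graph Q.graph).trans <|
    (exists₂_congr fun c _ => and_congr_right fun _ => cost_graph_le_iff P Q c).trans
      (exists_correspondenceCost_lt_iff P.func Q.func (𝓡 := {R | IsCorrespondence R})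
        (fun _ _ h hR => hR.mono h) fun _ hR => hR.nonempty).symm

theorem tDist_eq_ghfDist (p q : TSpace.{u, v} Ξ) :
    tDist p q = ghfDist _ (graphMap Ξ p) (graphMap Ξ q) := by
  refine eq_of_forall_gt_iff fun r => (tDist_lt_iff p q).trans ⟨?_, fun h => ?_⟩
  · rintro ⟨P, Q, rfl, rfl, h⟩
    exact (ghfDist_graph_lt_iff P Q).2 h
  · obtain ⟨P, rfl⟩ := Quotient.exists_rep p
    obtain ⟨Q, rfl⟩ := Quotient.exists_rep q
    exact ⟨P, Q, rfl, rfl, (ghfDist_graph_lt_iff P Q).1 h⟩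

theorem apply_eq_of_map_graphCompact_eq {X Y : CompObj.{u}} {φ : C(X, Ξ)} {ψ : C(Y, Ξ)}
    {e : X ≃ᵢ Y}
    (h : (markedFunctor.{u, v} Ξ).map e e.isometry (graphCompact X φ) = graphCompact Y ψ) (x : X) :
    ψ (e x) = φ x := by
  have hx : (e x, φ x) ∈ graphCompact Y ψ :=
    h ▸ mem_image_of_mem (Prod.map e id) (mem_range_self (f := fun x => (x, φ x)) x)
  obtain ⟨y, hy⟩ := hx
  obtain ⟨rfl, hψ⟩ := Prod.mk.inj hy
  exact hψ

variable (Ξ) in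
theorem graphMap_injective : Function.Injective (graphMap.{u, v} Ξ) := by
  intro p q h
  obtain ⟨P, rfl⟩ := Quotient.exists_rep p
  obtain ⟨Q, rfl⟩ := Quotient.exists_rep q
  obtain ⟨e, he⟩ : P.graph.Equivalent Q.graph := Quotient.exact h
  exact Quotient.sound ⟨e, apply_eq_of_map_graphCompact_eq he⟩

instance : MetricSpace (TSpace.{u, v} Ξ) :=
  MetricSpace.induced (graphMap Ξ) (graphMap_injective Ξ) inferInstance

end FunctionSpace

/-! ### Rooted spaces with a continuous function -/

section Snd

variable {τ₁ : CompFunctor.{u, v}} {τ₂ : CompFunctor.{u, w}}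

/-- The structured space `(X, b)` obtained from `(X, (a, b))`. -/
abbrev Structured.snd (P : Structured (prodFunctor τ₁ τ₂)) : Structured τ₂ :=
  ⟨P.space, P.str.2⟩

/-- The map `(X, (a, b)) ↦ (X, b)` on equivalence classes. -/
def CSpace.snd : CSpace (prodFunctor τ₁ τ₂) → CSpace τ₂ :=
  Quotient.map Structured.snd fun _ _ ⟨e, he⟩ => ⟨e, congrArg Prod.snd he⟩

theorem cost_eq_max (P Q : Structured (prodFunctor τ₁ τ₂)) (c : Coupling P.space Q.space) :
    c.cost P Q = max (dist (τ₁.map c.inl c.isometry_inl P.str.1)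
      (τ₁.map c.inr c.isometry_inr Q.str.1)) (c.cost P.snd Q.snd) :=
  max_left_comm _ _ _

theorem CSpace.ghfDist_snd_le (p q : CSpace (prodFunctor τ₁ τ₂)) :
    ghfDist τ₂ p.snd q.snd ≤ ghfDist _ p q := by
  obtain ⟨P, rfl⟩ := Quotient.exists_rep p
  obtain ⟨Q, rfl⟩ := Quotient.exists_rep q
  refine le_of_forall_gt fun r hr => ?_
  obtain ⟨c, hc⟩ := (ghfDist_lt_iff P Q).1 hr
  exact (ghfDist_lt_iff P.snd Q.snd).2 ⟨c, (max_lt_iff.1 (cost_eq_max P Q c ▸ hc)).2⟩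

theorem CSpace.continuous_snd [τ₁.IsNonexpansive] [τ₂.IsNonexpansive] :
    Continuous (CSpace.snd : CSpace (prodFunctor τ₁ τ₂) → CSpace τ₂) :=
  (LipschitzWith.mk_one CSpace.ghfDist_snd_le).continuous

end Snd

section PointedFunctionSpace

/-- The functor `τ(X) = Ξ`, whose structures are marks that do not depend on the space. -/
def constFunctor (Ξ : Type w) [MetricSpace Ξ] : CompFunctor.{u, w} where
  obj _ := Ξ
  map _ _ := id
  isometry_map _ _ := isometry_id
  map_id _ _ := rfl
  map_comp _ _ _ _ _ := rfl

instance (Ξ : Type w) [MetricSpace Ξ] : (constFunctor.{u, w} Ξ).IsNonexpansive where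
  dist_map_le _ _ a _ h := (dist_self a).trans_le (dist_nonneg.trans (h (Classical.arbitrary _)))

variable {Ξ : Type v} [MetricSpace Ξ]

/-- The functor whose structures are a mark, a point and a 1-marked compact subset. -/
abbrev rootMarkedFunctor (Ξ : Type v) [MetricSpace Ξ] : CompFunctor.{u, max u v} :=
  prodFunctor (constFunctor.{u, v} Ξ) (pointedMarkedFunctor.{u, v} Ξ)

/-- The structured space `(X, (φ(o), (o, gr_φ)))`. Recording also the mark `φ(o)` of the root makes
the distance of these structured spaces equal to the distance on `𝒯_*`. -/
abbrev PointedFunctionSpace.rootedGraph (P : PointedFunctionSpace.{u, v} Ξ) :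
    Structured (rootMarkedFunctor.{u, v} Ξ) :=
  ⟨P.space, (P.func P.root, (P.root, graphCompact P.space P.func))⟩

/-- The map `(X, o, φ) ↦ (X, (φ(o), (o, gr_φ)))` on equivalence classes. -/
def rootedGraphMap (Ξ : Type v) [MetricSpace Ξ] :
    PointedTSpace.{u, v} Ξ → CSpace (rootMarkedFunctor.{u, v} Ξ) :=
  Quotient.map PointedFunctionSpace.rootedGraph fun P Q ⟨e, ho, he⟩ =>
    ⟨e, Prod.ext ((he P.root).symm.trans (congrArg Q.func ho))
      (Prod.ext ho (map_graphCompact P.func Q.func e he))⟩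

theorem snd_rootedGraphMap (p : PointedTSpace.{u, v} Ξ) :
    (rootedGraphMap Ξ p).snd = pointedGraphMap Ξ p :=
  Quotient.inductionOn p fun _ => rfl

variable (Ξ) in
theorem pointedGraphMap_injective : Function.Injective (pointedGraphMap.{u, v} Ξ) := by
  intro p q h
  obtain ⟨P, rfl⟩ := Quotient.exists_rep p
  obtain ⟨Q, rfl⟩ := Quotient.exists_rep q
  obtain ⟨e, he⟩ : P.rootedGraph.snd.Equivalent Q.rootedGraph.snd := Quotient.exact h
  exact Quotient.sound ⟨e, congrArg Prod.fst he,
    apply_eq_of_map_graphCompact_eq (congrArg Prod.snd he)⟩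

variable (Ξ) in
theorem rootedGraphMap_injective : Function.Injective (rootedGraphMap.{u, v} Ξ) := by
  refine Function.Injective.of_comp (f := CSpace.snd) ?_
  exact (funext snd_rootedGraphMap : CSpace.snd ∘ rootedGraphMap Ξ = _) ▸
    pointedGraphMap_injective Ξ

theorem cost_snd_rootedGraph_le_iff (P Q : PointedFunctionSpace.{u, v} Ξ)
    (c : Coupling P.space Q.space) {r : ℝ} :
    c.cost P.rootedGraph.snd Q.rootedGraph.snd ≤ r ↔
      dist (c.inl P.root) (c.inr Q.root) ≤ r ∧
        IsCorrespondence (c.closePairs P.func Q.func r) := by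
  rw [← cost_graph_le_iff ⟨P.space, P.func⟩ ⟨Q.space, Q.func⟩, ← max_le_iff]
  exact iff_of_eq (congrArg (· ≤ r) (cost_eq_max (τ₁ := pointFunctor) (τ₂ := markedFunctor Ξ)
    P.rootedGraph.snd Q.rootedGraph.snd c))

theorem cost_rootedGraph_le_iff (P Q : PointedFunctionSpace.{u, v} Ξ)
    (c : Coupling P.space Q.space) {r : ℝ} :
    c.cost P.rootedGraph Q.rootedGraph ≤ r ↔
      IsCorrespondence (c.closePairs P.func Q.func r) ∧
        (P.root, Q.root) ∈ c.closePairs P.func Q.func r := by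
  rw [cost_eq_max, max_le_iff, cost_snd_rootedGraph_le_iff]
  constructor
  · rintro ⟨hfunc, hdist, hR⟩
    exact ⟨hR, hdist, hfunc⟩
  · rintro ⟨hR, hdist, hfunc⟩
    exact ⟨hfunc, hdist, hR⟩

theorem pointedTDist_lt_iff (p q : PointedTSpace.{u, v} Ξ) {r : ℝ} :
    pointedTDist p q < r ↔ ∃ P Q : PointedFunctionSpace.{u, v} Ξ,
      (⟦P⟧ : PointedTSpace Ξ) = p ∧ (⟦Q⟧ : PointedTSpace Ξ) = q ∧
      ∃ R : Set (P.space × Q.space), (IsCorrespondence R ∧ (P.root, Q.root) ∈ R) ∧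
        correspondenceCost P.func Q.func R < r := by
  obtain ⟨P, hP⟩ := Quotient.exists_rep p
  obtain ⟨Q, hQ⟩ := Quotient.exists_rep q
  constructor
  · intro h
    obtain ⟨_, ⟨P, Q, hP, hQ, R, hR, ho, rfl⟩, h⟩ := exists_lt_of_csInf_lt
      (by exact ⟨_, P, Q, hP, hQ, univ, isCorrespondence_univ _ _, mem_univ _, rfl⟩) h
    exact ⟨P, Q, hP, hQ, R, ⟨hR, ho⟩, h⟩
  · rintro ⟨P, Q, hP, hQ, R, ⟨hR, ho⟩, h⟩
    refine csInf_lt_of_lt ⟨0, ?_⟩ ⟨P, Q, hP, hQ, R, hR, ho, rfl⟩ h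
    rintro _ ⟨_, _, _, _, _, _, _, rfl⟩
    exact correspondenceCost_nonneg _ _ _

theorem ghfDist_rootedGraph_lt_iff (P Q : PointedFunctionSpace.{u, v} Ξ) {r : ℝ} :
    ghfDist _ ⟦P.rootedGraph⟧ ⟦Q.rootedGraph⟧ < r ↔
      ∃ R : Set (P.space × Q.space), (IsCorrespondence R ∧ (P.root, Q.root) ∈ R) ∧
        correspondenceCost P.func Q.func R < r :=
  (ghfDist_lt_iff_exists_le P.rootedGraph Q.rootedGraph).trans <|
    (exists₂_congr fun c _ => and_congr_right fun _ => cost_rootedGraph_le_iff P Q c).trans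
      (exists_correspondenceCost_lt_iff P.func Q.func
        (𝓡 := {R | IsCorrespondence R ∧ (P.root, Q.root) ∈ R})
        (fun _ _ h hR => ⟨hR.1.mono h, h hR.2⟩) fun _ hR => hR.1.nonempty).symm

theorem pointedTDist_eq_ghfDist (p q : PointedTSpace.{u, v} Ξ) :
    pointedTDist p q = ghfDist _ (rootedGraphMap Ξ p) (rootedGraphMap Ξ q) := by
  refine eq_of_forall_gt_iff fun r => (pointedTDist_lt_iff p q).trans ⟨?_, fun h => ?_⟩
  · rintro ⟨P, Q, rfl, rfl, h⟩
    exact (ghfDist_rootedGraph_lt_iff P Q).2 h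
  · obtain ⟨P, rfl⟩ := Quotient.exists_rep p
    obtain ⟨Q, rfl⟩ := Quotient.exists_rep q
    exact ⟨P, Q, rfl, rfl, (ghfDist_rootedGraph_lt_iff P Q).1 h⟩

instance : MetricSpace (PointedTSpace.{u, v} Ξ) :=
  MetricSpace.induced (rootedGraphMap Ξ) (rootedGraphMap_injective Ξ) inferInstance

theorem Coupling.dist_apply_le_of_isCorrespondence {X Y : CompObj.{u}} (c : Coupling X Y)
    {φ : X → Ξ} {ψ : Y → Ξ} {r s : ℝ} (hR : IsCorrespondence (c.closePairs φ ψ r))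
    (hψ : ∀ y y', dist y y' ≤ 2 * r → dist (ψ y) (ψ y') ≤ s) {x : X} {y : Y}
    (hxy : dist (c.inl x) (c.inr y) ≤ r) : dist (φ x) (ψ y) ≤ r + s := by
  obtain ⟨y', hdist, hmark⟩ := (isCorrespondence_iff.1 hR).1 x
  have hyy' : dist y' y ≤ 2 * r := by
    rw [← c.isometry_inr.dist_eq, two_mul]
    exact (dist_triangle_left _ _ _).trans (add_le_add hdist hxy)
  exact (dist_triangle _ _ _).trans (add_le_add hmark (hψ y' y hyy'))

/-- Here `δ` depends on the modulus of continuity of the function of `q`, which controls the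
distance of the marks of the two roots. -/
theorem exists_dist_lt_of_ghfDist_pointedGraphMap_lt (q : PointedTSpace.{u, v} Ξ) {ε : ℝ}
    (hε : 0 < ε) :
    ∃ δ > 0, ∀ p, ghfDist _ (pointedGraphMap Ξ p) (pointedGraphMap Ξ q) < δ → dist p q < ε := by
  obtain ⟨Q, rfl⟩ := Quotient.exists_rep q
  obtain ⟨δ, hδ, hψ⟩ := Metric.uniformContinuous_iff_le.1
    (CompactSpace.uniformContinuous_of_continuous Q.func.continuous) (ε / 2) (half_pos hε)
  refine ⟨min (ε / 2) (δ / 2), by positivity, fun p hp => ?_⟩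
  obtain ⟨P, rfl⟩ := Quotient.exists_rep p
  obtain ⟨c, r, hr, hc⟩ := (ghfDist_lt_iff_exists_le P.rootedGraph.snd Q.rootedGraph.snd).1 hp
  obtain ⟨hrε, hrδ⟩ := lt_min_iff.1 hr
  obtain ⟨hroot, hR⟩ := (cost_snd_rootedGraph_le_iff P Q c).1 hc
  refine (ghfDist_lt_iff P.rootedGraph Q.rootedGraph).2 ⟨c, ?_⟩
  rw [cost_eq_max]
  refine max_lt ?_ (by linarith)
  have hmark : dist (P.func P.root) (Q.func Q.root) ≤ r + ε / 2 :=
    c.dist_apply_le_of_isCorrespondence hR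
      (fun y y' h => hψ (h.trans (by linarith))) hroot
  exact hmark.trans_lt (by linarith)

theorem isEmbedding_pointedGraphMap : IsEmbedding (pointedGraphMap.{u, v} Ξ) := by
  refine ⟨isInducing_iff_nhds.2 fun q => le_antisymm ?_ ?_, pointedGraphMap_injective Ξ⟩
  · rw [← tendsto_iff_comap, ← funext snd_rootedGraphMap]
    have hroot : Isometry (rootedGraphMap.{u, v} Ξ) := fun _ _ => rfl
    exact (CSpace.continuous_snd.comp hroot.continuous).tendsto q
  · refine (nhds_basis_ball.comap _).le_basis_iff nhds_basis_ball |>.2 fun ε hε => ?_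
    exact exists_dist_lt_of_ghfDist_pointedGraphMap_lt q hε

end PointedFunctionSpace

/-! ### The images of the spaces with a continuous function -/

section FSigmaDelta

theorem IsFSigmaDelta.preimage {α β : Type*} [TopologicalSpace α] [TopologicalSpace β]
    {S : Set β} (hS : IsFSigmaDelta S) {f : α → β} (hf : Continuous f) :
    IsFSigmaDelta (f ⁻¹' S) := by
  obtain ⟨F, hF, rfl⟩ := hS
  exact ⟨fun n m => f ⁻¹' F n m, fun n m => (hF n m).preimage hf, by
    simp only [preimage_iInter, preimage_iUnion]⟩

theorem IsFSigmaDelta.measurableSet_borel {α : Type*} [TopologicalSpace α] {S : Set α}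
    (hS : IsFSigmaDelta S) : @MeasurableSet _ (borel α) S := by
  let _ := borel α
  have : BorelSpace α := ⟨rfl⟩
  obtain ⟨F, hF, rfl⟩ := hS
  exact .iInter fun n => .iUnion fun m => (hF n m).measurableSet

end FSigmaDelta

section Modulus

variable {Ξ : Type v} [MetricSpace Ξ]

/-- The projection of the marked set `K` to the space is onto, and the marks of points at distance
less than `δ` differ by at most `ε`. The graphs of continuous functions are the sets that have for
every `ε > 0` such a `δ > 0`. -/
def HasModulus {X : CompObj.{u}} (K : NonemptyCompacts (X × Ξ)) (δ ε : ℝ) : Prop :=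
  (∀ x, ∃ p ∈ K, p.1 = x) ∧ ∀ p ∈ K, ∀ q ∈ K, dist p.1 q.1 < δ → dist p.2 q.2 ≤ ε

theorem exists_hasModulus_graphCompact {X : CompObj.{u}} (φ : C(X, Ξ)) {ε : ℝ} (hε : 0 < ε) :
    ∃ m : ℕ, HasModulus (graphCompact X φ) (1 / (m + 1)) ε := by
  obtain ⟨δ, hδ, hφ⟩ := Metric.uniformContinuous_iff.1
    (CompactSpace.uniformContinuous_of_continuous φ.continuous) ε hε
  obtain ⟨m, hm⟩ := exists_nat_one_div_lt hδ
  refine ⟨m, fun x => ⟨_, mem_range_self x, rfl⟩, ?_⟩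
  rintro _ ⟨x, rfl⟩ _ ⟨y, rfl⟩ hxy
  exact (hφ (hxy.trans hm)).le

theorem exists_graphCompact_eq {X : CompObj.{u}} {K : NonemptyCompacts (X × Ξ)}
    (hK : ∀ ε > 0, ∃ δ > 0, HasModulus K δ ε) :
    ∃ φ, graphCompact X φ = K := by
  obtain ⟨_, -, honto, -⟩ := hK 1 one_pos
  have exists_mark : ∀ x, ∃ ξ, (x, ξ) ∈ K := fun x => by
    obtain ⟨p, hp, rfl⟩ := honto x
    exact ⟨p.2, hp⟩
  choose φ hφ using exists_mark
  have mark_unique : ∀ p ∈ K, φ p.1 = p.2 := by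
    refine fun p hp => dist_le_zero.1 (le_of_forall_gt_imp_ge_of_dense fun ε hε => ?_)
    obtain ⟨δ, hδ, -, h⟩ := hK ε hε
    exact h _ (hφ p.1) p hp (by simpa only [dist_self] using hδ)
  have hcont : Continuous φ := by
    refine Metric.continuous_iff'.2 fun x ε hε => ?_
    obtain ⟨δ, hδ, -, h⟩ := hK (ε / 2) (half_pos hε)
    filter_upwards [ball_mem_nhds x hδ] with y hy
    exact (h _ (hφ y) _ (hφ x) hy).trans_lt (half_lt_self hε)
  refine ⟨⟨φ, hcont⟩, NonemptyCompacts.ext (Subset.antisymm ?_ fun p hp => ⟨p.1, ?_⟩)⟩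
  · rintro _ ⟨x, rfl⟩
    exact hφ x
  · exact Prod.ext rfl (mark_unique p hp)

variable (Ξ) in
/-- The set of classes `(X, K)` with `HasModulus K δ ε`. -/
def modulusSet (δ ε : ℝ) : Set (CSpace (markedFunctor.{u, v} Ξ)) :=
  Quotient.mk _ '' {P | HasModulus P.str δ ε}

theorem HasModulus.exists_dist_fst_le {X Y : CompObj.{u}} {K : NonemptyCompacts (X × Ξ)}
    {L : NonemptyCompacts (Y × Ξ)} {δ ε : ℝ} (hL : HasModulus L δ ε) {c : Coupling X Y} {r : ℝ}
    (h : c.cost (τ := markedFunctor Ξ) ⟨X, K⟩ ⟨Y, L⟩ ≤ r) (x : X) :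
    ∃ p ∈ K, dist x p.1 ≤ r + r := by
  obtain ⟨hspace, hmarked⟩ := max_le_iff.1 h
  obtain ⟨y, hxy⟩ := (dist_rangeCompacts_le_iff (hf := c.isometry_inl.continuous)
    (hg := c.isometry_inr.continuous).1 hspace).1 x
  obtain ⟨q, hq, rfl⟩ := hL.1 y
  obtain ⟨p, hp, hpq, -⟩ :=
    ((dist_markedFunctor_map_le_iff c.isometry_inl c.isometry_inr).1 hmarked).2 q hq
  refine ⟨p, hp, ?_⟩
  rw [← c.isometry_inl.dist_eq]
  exact (dist_triangle_right _ _ _).trans (add_le_add hxy hpq)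

theorem HasModulus.dist_snd_le {X Y : CompObj.{u}} {K : NonemptyCompacts (X × Ξ)}
    {L : NonemptyCompacts (Y × Ξ)} {δ ε : ℝ} (hL : HasModulus L δ ε) {c : Coupling X Y} {r : ℝ}
    (h : c.cost (τ := markedFunctor Ξ) ⟨X, K⟩ ⟨Y, L⟩ ≤ r) {p q : X × Ξ} (hp : p ∈ K)
    (hq : q ∈ K) (hpq : r + dist p.1 q.1 + r < δ) : dist p.2 q.2 ≤ r + ε + r := by
  have hmarked := ((dist_markedFunctor_map_le_iff c.isometry_inl c.isometry_inr).1
    (max_le_iff.1 h).2).1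
  obtain ⟨p', hp', hpp', hmark_p⟩ := hmarked p hp
  obtain ⟨q', hq', hqq', hmark_q⟩ := hmarked q hq
  have hdist : dist p'.1 q'.1 < δ := by
    refine lt_of_le_of_lt ?_ hpq
    rw [← c.isometry_inl.dist_eq, ← c.isometry_inr.dist_eq]
    rw [dist_comm] at hpp'
    exact (dist_triangle4 _ _ _ _).trans (by gcongr)
  rw [dist_comm] at hmark_q
  exact (dist_triangle4 _ _ _ _).trans (by gcongr; exact hL.2 p' hp' q' hq' hdist)

theorem hasModulus_of_mem_closure {P : Structured (markedFunctor.{u, v} Ξ)} {δ ε : ℝ}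
    (hP : (⟦P⟧ : CSpace (markedFunctor.{u, v} Ξ)) ∈ closure (modulusSet Ξ δ ε)) :
    HasModulus P.str δ ε := by
  obtain ⟨X, (K : NonemptyCompacts (X × Ξ))⟩ := P
  have exists_near : ∀ r > 0, ∃ (Y : CompObj.{u}) (L : NonemptyCompacts (Y × Ξ)),
      HasModulus L δ ε ∧ ∃ c : Coupling X Y,
        c.cost (τ := markedFunctor.{u, v} Ξ) ⟨X, K⟩ ⟨Y, L⟩ ≤ r := fun r hr => by
    obtain ⟨_, ⟨⟨Y, L⟩, hL, rfl⟩, hlt⟩ :=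
      (Metric.mem_closure_iff (α := CSpace (markedFunctor.{u, v} Ξ))).1 hP r hr
    obtain ⟨c, hc⟩ := (ghfDist_lt_iff _ _).1 hlt
    exact ⟨Y, L, hL, c, hc.le⟩
  constructor
  · intro x
    change x ∈ Prod.fst '' (K : Set (X × Ξ))
    rw [← (K.isCompact.image continuous_fst).isClosed.closure_eq, Metric.mem_closure_iff]
    intro r hr
    obtain ⟨Y, L, hL, c, hc⟩ := exists_near (r / 3) (by positivity)
    obtain ⟨p, hp, hxp⟩ := hL.exists_dist_fst_le hc x
    exact ⟨p.1, mem_image_of_mem _ hp, by linarith⟩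
  · refine fun p hp q hq hpq => le_of_forall_pos_le_add fun r hr => ?_
    obtain ⟨Y, L, hL, c, hc⟩ := exists_near (min (r / 2) ((δ - dist p.1 q.1) / 3))
      (lt_min (half_pos hr) (by linarith))
    obtain ⟨hcr, hcδ⟩ := le_min_iff.1 hc
    refine (hL.dist_snd_le (c := c) le_rfl hp hq (by linarith)).trans (by linarith)

theorem isClosed_modulusSet (δ ε : ℝ) : IsClosed (modulusSet.{u, v} Ξ δ ε) := by
  refine isClosed_of_closure_subset fun p hp => ?_
  obtain ⟨P, rfl⟩ := Quotient.exists_rep p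
  exact ⟨P, hasModulus_of_mem_closure hp, rfl⟩

variable (Ξ)

theorem range_graphMap : range (graphMap.{u, v} Ξ) =
    ⋂ n : ℕ, ⋃ m : ℕ, modulusSet Ξ (1 / (m + 1)) (1 / (n + 1)) := by
  refine Subset.antisymm ?_ fun p hp => ?_
  · rintro _ ⟨p, rfl⟩
    obtain ⟨P, rfl⟩ := Quotient.exists_rep p
    refine mem_iInter.2 fun n => mem_iUnion.2 ?_
    obtain ⟨m, hm⟩ := exists_hasModulus_graphCompact P.func (ε := 1 / (n + 1)) (by positivity)
    exact ⟨m, P.graph, hm, rfl⟩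
  · obtain ⟨⟨X, K⟩, rfl⟩ := Quotient.exists_rep p
    obtain ⟨φ, rfl⟩ := exists_graphCompact_eq (K := K) fun ε hε => by
      obtain ⟨n, hn⟩ := exists_nat_one_div_lt hε
      obtain ⟨m, hm⟩ := mem_iUnion.1 (mem_iInter.1 hp n)
      obtain ⟨honto, hosc⟩ := hasModulus_of_mem_closure (P := ⟨X, K⟩)
        (subset_closure (X := CSpace (markedFunctor.{u, v} Ξ)) hm)
      exact ⟨1 / (m + 1), by positivity, honto, fun p hp q hq hpq =>
        (hosc p hp q hq hpq).trans hn.le⟩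
    exact ⟨⟦⟨X, φ⟩⟧, rfl⟩

theorem isFSigmaDelta_range_graphMap : IsFSigmaDelta (range (graphMap.{u, v} Ξ)) :=
  ⟨_, fun _ _ => isClosed_modulusSet _ _, range_graphMap Ξ⟩

theorem range_pointedGraphMap : range (pointedGraphMap.{u, v} Ξ) =
    (CSpace.snd : CSpace (pointedMarkedFunctor Ξ) → CSpace (markedFunctor Ξ)) ⁻¹'
      range (graphMap Ξ) := by
  refine Subset.antisymm ?_ fun p hp => ?_
  · rintro _ ⟨p, rfl⟩
    obtain ⟨P, rfl⟩ := Quotient.exists_rep p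
    exact ⟨⟦⟨P.space, P.func⟩⟧, rfl⟩
  · obtain ⟨P, rfl⟩ := Quotient.exists_rep p
    obtain ⟨q, hq⟩ := hp
    obtain ⟨Q, rfl⟩ := Quotient.exists_rep q
    obtain ⟨e, he⟩ : Q.graph.Equivalent (Structured.snd P) := Quotient.exact hq
    exact ⟨⟦⟨Q.space, e.symm P.str.1, Q.func⟩⟧,
      Quotient.sound ⟨e, Prod.ext (e.apply_symm_apply _) he⟩⟩

theorem isFSigmaDelta_range_pointedGraphMap :
    IsFSigmaDelta (range (pointedGraphMap.{u, v} Ξ)) := by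
  rw [range_pointedGraphMap]
  exact (isFSigmaDelta_range_graphMap Ξ).preimage CSpace.continuous_snd

end Modulus

end SpatialTrees

end

theorem proposition5p1 (Ξ : Type v) [MetricSpace Ξ] [CompleteSpace Ξ] [SeparableSpace Ξ] :
    (∃ (_ : MetricSpace (SpatialTrees.TSpace.{u, v} Ξ))
        (_ : MetricSpace (SpatialTrees.CSpace (SpatialTrees.markedFunctor.{u, v} Ξ))),
      (∀ p q : SpatialTrees.TSpace.{u, v} Ξ, dist p q = SpatialTrees.tDist p q) ∧
      (∀ p q : SpatialTrees.CSpace (SpatialTrees.markedFunctor.{u, v} Ξ),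
        dist p q = SpatialTrees.ghfDist _ p q) ∧
      CompleteSpace (SpatialTrees.CSpace (SpatialTrees.markedFunctor.{u, v} Ξ)) ∧
      SeparableSpace (SpatialTrees.CSpace (SpatialTrees.markedFunctor.{u, v} Ξ)) ∧
      Isometry (SpatialTrees.graphMap.{u, v} Ξ) ∧
      SpatialTrees.IsFSigmaDelta (range (SpatialTrees.graphMap.{u, v} Ξ)) ∧
      @MeasurableSet _ (borel _) (range (SpatialTrees.graphMap.{u, v} Ξ))) ∧
    (∃ (_ : MetricSpace (SpatialTrees.PointedTSpace.{u, v} Ξ))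
        (_ : MetricSpace (SpatialTrees.CSpace (SpatialTrees.pointedMarkedFunctor.{u, v} Ξ))),
      (∀ p q : SpatialTrees.PointedTSpace.{u, v} Ξ,
        dist p q = SpatialTrees.pointedTDist p q) ∧
      (∀ p q : SpatialTrees.CSpace (SpatialTrees.pointedMarkedFunctor.{u, v} Ξ),
        dist p q = SpatialTrees.ghfDist _ p q) ∧
      CompleteSpace (SpatialTrees.CSpace (SpatialTrees.pointedMarkedFunctor.{u, v} Ξ)) ∧
      SeparableSpace (SpatialTrees.CSpace (SpatialTrees.pointedMarkedFunctor.{u, v} Ξ)) ∧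
      Topology.IsEmbedding (SpatialTrees.pointedGraphMap.{u, v} Ξ) ∧
      SpatialTrees.IsFSigmaDelta (range (SpatialTrees.pointedGraphMap.{u, v} Ξ)) ∧
      @MeasurableSet _ (borel _) (range (SpatialTrees.pointedGraphMap.{u, v} Ξ))) := by
  have hrange := SpatialTrees.isFSigmaDelta_range_graphMap.{u, v} Ξ
  have hrange_pointed := SpatialTrees.isFSigmaDelta_range_pointedGraphMap.{u, v} Ξ
  exact ⟨⟨inferInstance, inferInstance, fun p q => (SpatialTrees.tDist_eq_ghfDist p q).symm,
      fun _ _ => rfl, inferInstance, inferInstance, fun _ _ => rfl, hrange,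
      hrange.measurableSet_borel⟩,
    ⟨inferInstance, inferInstance, fun p q => (SpatialTrees.pointedTDist_eq_ghfDist p q).symm,
      fun _ _ => rfl, inferInstance, inferInstance, SpatialTrees.isEmbedding_pointedGraphMap,
      hrange_pointed, hrange_pointed.measurableSet_borel⟩⟩
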